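/- Let $(\Omega,\mathcal F,\mathbb P)$ be a probability space with a filtration $(\mathcal F_k)_{k\ge0}$, let $\mathcal F_{-1}=\{\emptyset,\Omega\}$, and let $(w_k)_{k\ge 0}$ be real random variables such that, for all $k\ge0$, $w_k$ is $\mathcal F_k$-measurable, $\mathbb E[w_k\mid\mathcal F_{k-1}]=0$ and $\mathbb E[w_k^2\mid\mathcal F_{k-1}]=1$ (for instance, $\mathcal F_k$ may be the $\sigma$-algebra generated by $w_0,\dots,w_k$). For $\rho\in\mathbb R$ let $L^{2,\rho}(\mathbb R^p)$ be the set of processes $g=(g_k)_{k\ge0}$ with values in $\mathbb R^p$ such that $g_k$ is $\mathcal F_{k-1}$-measurable and $\mathbb E\sum_{k\ge0}e^{-\rho k}|g_k|^2<\infty$. Let $L^{\infty}$ be the set of matrix-valued processes $H=(H_k)_{k\ge0}$ with $H_k$ $\mathcal F_{k-1}$-measurable and $\|H\|_\infty:=\sup_k\operatorname{ess\,sup}_\omega|H_k|<\infty$, where $|H_k|=\sqrt{\operatorname{tr}(H_kH_k^\top)}$. For a process $y$ write $y'_{k+1}=\mathbb E[y_{k+1}\mid\mathcal F_{k-1}]$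 and $z'_{k+1}=\mathbb E[y_{k+1}w_k\mid\mathcal F_{k-1}]$. Equations and equalities of processes are understood almost surely, for every $k\ge0$. Let $A,B,Q,L\in L^\infty$ take values in $\mathbb R^{n\times n}$, $C\in L^\infty$ in $\mathbb R^{n\times m}$ and $R\in L^\infty$ in $\mathbb R^{m\times m}$; let $\alpha\in L^{2,\rho}(\mathbb R^n)$ and $M\in\mathbb R^{n\times n}$. Assume that $M$ is symmetric positive definite, that for every $k$ the matrices $Q_k$, $L_k$, $R_k$ are almost surely symmetric with $Q_k\ge0$ and $L_k\ge0$, that there is a constant $\delta>0$ with $R_k\ge\delta I_m$ almost surely for every $k$, and that $$\rho<-\ln\bigl(6(\|A\|_\infty+\|B\|_\infty)^2\bigr)\qquad(\text{with } -\ln 0=+\infty).$$ The admissible controls are the processes $v\in\mathbb U:=L^{2,\rho}(\mathbb R^m)$, with state the solution $y\in L^{2,\rho}(\mathbb R^n)$ of $$y_k=A_ky'_{k+1}+B_kz'_{k+1}+C_kv_k+\alpha_k,\qquad k\ge0,$$ and cost $$J(v)=\tfrac12\,\mathbb E\Bigl\{\langle My_0,y_0\rangle+\sum_{k\ge0}e^{-\rho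 k}\bigl[\langle Q_ky'_{k+1},y'_{k+1}\rangle+\langle L_kz'_{k+1},z'_{k+1}\rangle+\langle R_kv_k,v_k\rangle\bigr]\Bigr\}.$$ Then $J$ is well defined on $\mathbb U$ (every $v\in\mathbb U$ has exactly one state, and the series and the expectation in $J(v)$ converge), and the Hamiltonian system $$\left\{\begin{aligned} \bar x_{k+1}&=e^{\rho}A_k^\top\bar x_k-e^{\rho}Q_k\bar y'_{k+1}+e^{\rho}\bigl(B_k^\top\bar x_k-L_k\bar z'_{k+1}\bigr)w_k,\\ \bar y_k&=A_k\bar y'_{k+1}+B_k\bar z'_{k+1}+C_k\bar v_k+\alpha_k,\qquad k\ge0,\\ \bar x_0&=-M\bar y_0,\\ 0&=C_k^\top\bar x_k-R_k\bar v_k \end{aligned}\right.$$ has a unique solution $(\bar x,\bar y)\in L^{2,\rho}(\mathbb R^n)\times L^{2,\rho}(\mathbb R^n)$, with $\bar v_k=R_k^{-1}C_k^\top\bar x_k$. Moreover, this $\bar v$ is the unique optimal control, that is, the unique element of $\mathbb U$ with $J(\bar v)=\inf_{v\in\mathbb U}J(v)$. -/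

import Mathlib

open MeasureTheory Matrix
open scoped ENNReal

noncomputable section

namespace BLQ

variable {Ω : Type*} {m0 : MeasurableSpace Ω}

/-- The information available to a process at time `k`, namely `F_{k-1}`: the filtration shifted
by one step, where `F_{-1}` is the trivial σ-algebra. -/
@[reducible] def past (ℱ : Filtration ℕ m0) : ℕ → MeasurableSpace Ω
  | 0 => ⊥
  | k + 1 => ℱ k

/-- `w` is a real martingale difference sequence with respect to `F`, with conditional variance
one: `w_k` is `F_k`-measurable, `E[w_k | F_{k-1}] = 0` and `E[w_k ^ 2 | F_{k-1}] = 1`, `k ≥ 0`. -/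
structure IsNoise (P : Measure Ω) (ℱ : Filtration ℕ m0) (w : ℕ → Ω → ℝ) : Prop where
  adapted : ∀ k, StronglyMeasurable[ℱ k] (w k)
  sqIntegrable : ∀ k, MemLp (w k) 2 P
  condMean : ∀ k, P[w k | past ℱ k] =ᵐ[P] fun _ => 0
  condVar : ∀ k, P[fun ω => w k ω ^ 2 | past ℱ k] =ᵐ[P] fun _ => 1

/-- The norm `|A| = √ tr (A Aᵀ)` of a matrix. -/
def matNorm {p q : ℕ} (A : Matrix (Fin p) (Fin q) ℝ) : ℝ :=
  √ (A * Aᵀ).trace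

/-- The essential supremum norm of a matrix-valued process, over time and chance. -/
def linfNorm (P : Measure Ω) {p q : ℕ} (A : ℕ → Ω → Matrix (Fin p) (Fin q) ℝ) : ℝ≥0∞ :=
  ⨆ k, essSup (fun ω => ENNReal.ofReal (matNorm (A k ω))) P

/-- `A` is an essentially bounded matrix-valued process with `A_k` measurable for `F_{k-1}`. -/
structure IsLinf (P : Measure Ω) (ℱ : Filtration ℕ m0) {p q : ℕ}
    (A : ℕ → Ω → Matrix (Fin p) (Fin q) ℝ) : Prop where
  adapted : ∀ k, StronglyMeasurable[past ℱ k] (A k)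
  bounded : linfNorm P A < ∞

/-- The space `L^{2,ρ}`: `g_k` is `F_{k-1}`-measurable and `E ∑ e^{-ρ k} |g_k| ^ 2 < ∞`. -/
structure IsL2 (P : Measure Ω) (ℱ : Filtration ℕ m0) (ρ : ℝ) {p : ℕ}
    (g : ℕ → Ω → EuclideanSpace ℝ (Fin p)) : Prop where
  adapted : ∀ k, StronglyMeasurable[past ℱ k] (g k)
  finite : ∫⁻ ω, ∑' k : ℕ, ENNReal.ofReal (Real.exp (-ρ * k)) * ‖g k ω‖ₑ ^ 2 ∂P < ∞

/-- Two processes are equal when they agree almost surely at every time. -/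
def Same (P : Measure Ω) {p : ℕ} (g h : ℕ → Ω → EuclideanSpace ℝ (Fin p)) : Prop :=
  ∀ k, g k =ᵐ[P] h k

/-- `nextMean P F y k` is the variable usually written `y'_{k+1} = E[y_{k+1} | F_{k-1}]`. -/
def nextMean (P : Measure Ω) (ℱ : Filtration ℕ m0) {p : ℕ}
    (y : ℕ → Ω → EuclideanSpace ℝ (Fin p)) (k : ℕ) : Ω → EuclideanSpace ℝ (Fin p) :=
  P[y (k + 1) | past ℱ k]

/-- `nextCov P F w y k` is the variable usually written `z'_{k+1} = E[y_{k+1} w_k | F_{k-1}]`. -/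
def nextCov (P : Measure Ω) (ℱ : Filtration ℕ m0) (w : ℕ → Ω → ℝ) {p : ℕ}
    (y : ℕ → Ω → EuclideanSpace ℝ (Fin p)) (k : ℕ) : Ω → EuclideanSpace ℝ (Fin p) :=
  P[fun ω => w k ω • y (k + 1) ω | past ℱ k]

/-- The coefficients of a backward linear-quadratic problem with state dimension `n` and control
dimension `m`. -/
structure Coeffs (Ω : Type*) (n m : ℕ) where
  A : ℕ → Ω → Matrix (Fin n) (Fin n) ℝ
  B : ℕ → Ω → Matrix (Fin n) (Fin n) ℝ
  C : ℕ → Ω → Matrix (Fin n) (Fin m) ℝ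
  α : ℕ → Ω → EuclideanSpace ℝ (Fin n)
  M : Matrix (Fin n) (Fin n) ℝ
  Q : ℕ → Ω → Matrix (Fin n) (Fin n) ℝ
  L : ℕ → Ω → Matrix (Fin n) (Fin n) ℝ
  R : ℕ → Ω → Matrix (Fin m) (Fin m) ℝ

variable {n m : ℕ}

/-- The backward equation `y_k = A_k y'_{k+1} + B_k z'_{k+1} + C_k v_k + α_k` almost surely, for
all `k`. -/
def BackwardEq (P : Measure Ω) (ℱ : Filtration ℕ m0) (w : ℕ → Ω → ℝ) (c : Coeffs Ω n m)
    (v : ℕ → Ω → EuclideanSpace ℝ (Fin m)) (y : ℕ → Ω → EuclideanSpace ℝ (Fin n)) : Prop :=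
  ∀ k, ∀ᵐ ω ∂P, y k ω =
    toEuclideanLin (c.A k ω) (nextMean P ℱ y k ω)
      + toEuclideanLin (c.B k ω) (nextCov P ℱ w y k ω)
      + toEuclideanLin (c.C k ω) (v k ω) + c.α k ω

/-- `y` is the state of the control `v`: a solution in `L^{2,ρ}` of the backward equation. -/
def IsState (P : Measure Ω) (ℱ : Filtration ℕ m0) (w : ℕ → Ω → ℝ) (ρ : ℝ) (c : Coeffs Ω n m)
    (v : ℕ → Ω → EuclideanSpace ℝ (Fin m)) (y : ℕ → Ω → EuclideanSpace ℝ (Fin n)) : Prop :=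
  IsL2 P ℱ ρ y ∧ BackwardEq P ℱ w c v y

/-- The term of index `k` in the series of the cost. -/
def runningCost (P : Measure Ω) (ℱ : Filtration ℕ m0) (w : ℕ → Ω → ℝ) (ρ : ℝ) (c : Coeffs Ω n m)
    (v : ℕ → Ω → EuclideanSpace ℝ (Fin m)) (y : ℕ → Ω → EuclideanSpace ℝ (Fin n))
    (k : ℕ) (ω : Ω) : ℝ :=
  Real.exp (-ρ * k) *
    (inner ℝ (toEuclideanLin (c.Q k ω) (nextMean P ℱ y k ω)) (nextMean P ℱ y k ω)
      + inner ℝ (toEuclideanLin (c.L k ω) (nextCov P ℱ w y k ω)) (nextCov P ℱ w y k ω)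
      + inner ℝ (toEuclideanLin (c.R k ω) (v k ω)) (v k ω))

/-- The random variable whose half expectation is the cost. -/
def pathCost (P : Measure Ω) (ℱ : Filtration ℕ m0) (w : ℕ → Ω → ℝ) (ρ : ℝ) (c : Coeffs Ω n m)
    (v : ℕ → Ω → EuclideanSpace ℝ (Fin m)) (y : ℕ → Ω → EuclideanSpace ℝ (Fin n)) (ω : Ω) : ℝ :=
  inner ℝ (toEuclideanLin c.M (y 0 ω)) (y 0 ω) + ∑' k, runningCost P ℱ w ρ c v y k ω

open Classical in
/-- The state process of the control `v` (zero if the backward equation has no solution in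
`L^{2,ρ}`). -/
def stateOf (P : Measure Ω) (ℱ : Filtration ℕ m0) (w : ℕ → Ω → ℝ) (ρ : ℝ) (c : Coeffs Ω n m)
    (v : ℕ → Ω → EuclideanSpace ℝ (Fin m)) : ℕ → Ω → EuclideanSpace ℝ (Fin n) :=
  if h : ∃ y, IsState P ℱ w ρ c v y then h.choose else 0

/-- The cost functional `J`. -/
def cost (P : Measure Ω) (ℱ : Filtration ℕ m0) (w : ℕ → Ω → ℝ) (ρ : ℝ) (c : Coeffs Ω n m)
    (v : ℕ → Ω → EuclideanSpace ℝ (Fin m)) : ℝ :=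
  (1 / 2) * ∫ ω, pathCost P ℱ w ρ c v (stateOf P ℱ w ρ c v) ω ∂P

/-- `J` is meaningful at the control `v`: the backward equation has a solution in `L^{2,ρ}`, unique
up to almost sure equality, and for it the series and the expectation in `J` converge. -/
def CostWellDefined (P : Measure Ω) (ℱ : Filtration ℕ m0) (w : ℕ → Ω → ℝ) (ρ : ℝ)
    (c : Coeffs Ω n m) (v : ℕ → Ω → EuclideanSpace ℝ (Fin m)) : Prop :=
  ∃ y, IsState P ℱ w ρ c v y ∧ (∀ y', IsState P ℱ w ρ c v y' → Same P y' y) ∧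
    (∀ᵐ ω ∂P, Summable fun k => runningCost P ℱ w ρ c v y k ω) ∧
    Integrable (pathCost P ℱ w ρ c v y) P

/-- `v` is an optimal control: it is admissible and attains the infimum of `J` over all
admissible controls. -/
def IsOptimal (P : Measure Ω) (ℱ : Filtration ℕ m0) (w : ℕ → Ω → ℝ) (ρ : ℝ) (c : Coeffs Ω n m)
    (v : ℕ → Ω → EuclideanSpace ℝ (Fin m)) : Prop :=
  IsL2 P ℱ ρ v ∧ IsLeast (cost P ℱ w ρ c '' {u | IsL2 P ℱ ρ u}) (cost P ℱ w ρ c v)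

/-- `(x, y)`, with the control `v`, solves the Hamiltonian system; `x` and `y` are in `L^{2,ρ}`
and the equations hold almost surely. -/
structure IsHamiltonianSolution (P : Measure Ω) (ℱ : Filtration ℕ m0) (w : ℕ → Ω → ℝ) (ρ : ℝ)
    (c : Coeffs Ω n m) (x y : ℕ → Ω → EuclideanSpace ℝ (Fin n))
    (v : ℕ → Ω → EuclideanSpace ℝ (Fin m)) : Prop where
  memX : IsL2 P ℱ ρ x
  memY : IsL2 P ℱ ρ y
  forward : ∀ k, ∀ᵐ ω ∂P, x (k + 1) ω =
    Real.exp ρ • toEuclideanLin (c.A k ω)ᵀ (x k ω)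
      - Real.exp ρ • toEuclideanLin (c.Q k ω) (nextMean P ℱ y k ω)
      + w k ω • Real.exp ρ • (toEuclideanLin (c.B k ω)ᵀ (x k ω)
          - toEuclideanLin (c.L k ω) (nextCov P ℱ w y k ω))
  backward : BackwardEq P ℱ w c v y
  initial : ∀ᵐ ω ∂P, x 0 ω = -toEuclideanLin c.M (y 0 ω)
  stationary : ∀ k, ∀ᵐ ω ∂P,
    0 = toEuclideanLin (c.C k ω)ᵀ (x k ω) - toEuclideanLin (c.R k ω) (v k ω)

/-- The control `R_k⁻¹ C_kᵀ x_k`. -/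
def feedback (c : Coeffs Ω n m) (x : ℕ → Ω → EuclideanSpace ℝ (Fin n)) :
    ℕ → Ω → EuclideanSpace ℝ (Fin m) :=
  fun k ω => toEuclideanLin (c.R k ω)⁻¹ (toEuclideanLin (c.C k ω)ᵀ (x k ω))

end BLQ

end

/-! Everything takes place in one Hilbert space. Give `ℕ × Ω` the σ-algebra of predictable sets and
the measure `∑ exp(-ρ k) δ_k ⊗ P`; then `L^{2,ρ}` is its `L²` space, with processes identified when
they agree almost surely at every time.

The delay `S_φ`, `(S_φ g)_{k+1} = φ_k g_k` and `(S_φ g)_0 = 0`, multiplies norms by `exp(-ρ/2)` for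
`φ = 1` as well as for `φ = w`, since in both cases `E[φ_k² | F_{k-1}] = 1`. Its adjoint times `exp
ρ` sends `y` to `E[φ_k y_{k+1} | F_{k-1}]`, which is `y'` or `z'`, and so has norm at most
`exp(ρ/2)` (`IsUnitWeight.proc_nextOp`, `IsUnitWeight.norm_nextOp_le`). Hence the state equation
reads `y = T y + C v + α` with `‖T‖ ≤ (‖A‖ + ‖B‖) exp(ρ/2) < 1`, and `1 - T` is invertible.

The cost is `(⟨N y, y⟩ + ⟨R v, v⟩) / 2` with `N` symmetric and nonnegative and `R ≥ δ`. Expanding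
the adjoints turns the Hamiltonian system into `x = T* x - N y`, `C* x = R v`
(`IsProblem.costate_iff`): these are the critical point equations of a strongly convex quadratic
problem. Eliminating `x` and `y` leaves a coercive equation for `v`, solvable by Lax–Milgram
(`exists_isCritical`). At a critical point the first-order term of the cost vanishes, so the cost
grows at least like `δ ‖u - v‖² / 2` (`IsCritical.cost_ge`); optimality and both uniqueness claims
follow. -/

noncomputable section

namespace BLQ

/-! ### Linear-quadratic problems in Hilbert space -/

section Abstract

variable {X U : Type*} [NormedAddCommGroup X] [InnerProductSpace ℝ X] [CompleteSpace X]
  [NormedAddCommGroup U] [InnerProductSpace ℝ U] [CompleteSpace U]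

/-- A linear equation `y = T y + b` with a contraction `T` has exactly one solution. -/
theorem existsUnique_eq_add_of_norm_lt_one (T : X →L[ℝ] X) (hT : ‖T‖ < 1) (b : X) :
    ∃! y, y = T y + b := by
  have hu := isUnit_one_sub_of_norm_lt_one hT
  obtain ⟨S, hS⟩ := hu
  have h1 : ∀ y, (S⁻¹ : (X →L[ℝ] X)ˣ).1 (y - T y) = y := fun y => by
    have := congrArg (fun F : X →L[ℝ] X => F y) S.inv_mul
    simpa [hS] using this
  have h2 : ∀ y, (S⁻¹ : (X →L[ℝ] X)ˣ).1 y - T ((S⁻¹ : (X →L[ℝ] X)ˣ).1 y) = y := fun y => by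
    have := congrArg (fun F : X →L[ℝ] X => F y) S.mul_inv
    simpa [hS] using this
  refine ⟨(S⁻¹ : (X →L[ℝ] X)ˣ).1 b, ?_, fun y hy => ?_⟩
  · exact sub_eq_iff_eq_add'.1 (h2 b)
  · rw [← h1 y]
    congr 1
    exact sub_eq_iff_eq_add'.2 hy

/-- The abstract Hamiltonian system of a linear-quadratic problem. -/
structure IsCritical (T N : X →L[ℝ] X) (C : U →L[ℝ] X) (R : U →L[ℝ] U) (α : X)
    (x y : X) (v : U) : Prop where
  state : y = T y + C v + α
  costate : x = T.adjoint x - N y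
  stationary : C.adjoint x = R v

/-- A linear operator that is bounded below in the quadratic form sense is onto. -/
theorem surjective_of_coercive (G : U →L[ℝ] U) {δ : ℝ} (hδ : 0 < δ)
    (hG : ∀ v, δ * ‖v‖ ^ 2 ≤ inner ℝ (G v) v) : Function.Surjective G := by
  have hc : IsCoercive ((innerSL ℝ).comp G : U →L[ℝ] U →L[ℝ] ℝ) :=
    ⟨δ, hδ, fun u => by simpa [sq, mul_assoc] using hG u⟩
  intro b
  obtain ⟨v, hv⟩ := hc.continuousLinearEquivOfBilin.surjective b
  refine ⟨v, ext_inner_right ℝ fun u => ?_⟩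
  have := hc.continuousLinearEquivOfBilin_apply v u
  rw [hv] at this
  simpa using this.symm

/-- The quadratic cost exceeds its value at a critical point by at least `δ ‖v - v̄‖ ^ 2`. -/
theorem IsCritical.cost_ge {T N : X →L[ℝ] X} {C : U →L[ℝ] X} {R : U →L[ℝ] U} {α : X}
    {x y : X} {v : U} (h : IsCritical T N C R α x y v)
    (hN : ∀ y, 0 ≤ inner ℝ (N y) y) (hNs : ∀ y z, inner ℝ (N y) z = inner ℝ y (N z))
    {δ : ℝ} (hR : ∀ v, δ * ‖v‖ ^ 2 ≤ inner ℝ (R v) v)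
    (hRs : ∀ u v, inner ℝ (R u) v = inner ℝ u (R v)) {u : U} {z : X} (hz : z = T z + C u + α) :
    inner ℝ (N y) y + inner ℝ (R v) v + δ * ‖u - v‖ ^ 2
      ≤ inner ℝ (N z) z + inner ℝ (R u) u := by
  have hd : z - y = T (z - y) + C (u - v) := by
    rw [map_sub, map_sub]
    nth_rw 1 [hz, h.state]
    abel
  -- The first variation vanishes: with `d = z - y`, the critical equations turn it into `⟨x, T d -
  -- d⟩ + ⟨x, C (u - v)⟩`, and `d = T d + C (u - v)`.
  have hcross : inner ℝ (N y) (z - y) + inner ℝ (R v) (u - v) = 0 := by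
    have h1 : N y = T.adjoint x - x := by
      have := h.costate
      rw [eq_sub_iff_add_eq] at this
      rw [← this]; abel
    rw [h1, ← h.stationary, inner_sub_left, ContinuousLinearMap.adjoint_inner_left,
      ContinuousLinearMap.adjoint_inner_left]
    nth_rw 2 [hd]
    rw [inner_add_right]; ring
  have e1 : inner ℝ (N z) z = inner ℝ (N y) y + 2 * inner ℝ (N y) (z - y)
      + inner ℝ (N (z - y)) (z - y) := by
    have := hNs z y
    rw [map_sub, inner_sub_left, inner_sub_right, inner_sub_right, this,
      real_inner_comm (N y) z]; ring
  have e2 : inner ℝ (R u) u = inner ℝ (R v) v + 2 * inner ℝ (R v) (u - v)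
      + inner ℝ (R (u - v)) (u - v) := by
    have := hRs u v
    rw [map_sub, inner_sub_left, inner_sub_right, inner_sub_right, this,
      real_inner_comm (R v) u]; ring
  have := hN (z - y)
  have := hR (u - v)
  linarith

/-- The Hamiltonian system of a linear-quadratic problem with a contraction as state operator is
solvable. -/
theorem exists_isCritical (T N : X →L[ℝ] X) (hT : ‖T‖ < 1) (C : U →L[ℝ] X) (R : U →L[ℝ] U) (α : X)
    (hN : ∀ y, 0 ≤ inner ℝ (N y) y) {δ : ℝ} (hδ : 0 < δ)
    (hR : ∀ v, δ * ‖v‖ ^ 2 ≤ inner ℝ (R v) v) :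
    ∃ x y v, IsCritical T N C R α x y v := by
  obtain ⟨S, hS⟩ := isUnit_one_sub_of_norm_lt_one hT
  set Si : X →L[ℝ] X := (S⁻¹ : (X →L[ℝ] X)ˣ).1 with hSi
  have h2 : ∀ y, Si y - T (Si y) = y := fun y => by
    have := congrArg (fun F : X →L[ℝ] X => F y) S.mul_inv
    simpa [hS] using this
  have h3 : ∀ y, Si (y - T y) = y := fun y => by
    have := congrArg (fun F : X →L[ℝ] X => F y) S.inv_mul
    simpa [hS] using this
  have h4 : ∀ x, Si.adjoint x - T.adjoint (Si.adjoint x) = x := fun x => by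
    refine ext_inner_right ℝ fun y => ?_
    rw [inner_sub_left, ContinuousLinearMap.adjoint_inner_left,
      ContinuousLinearMap.adjoint_inner_left, ContinuousLinearMap.adjoint_inner_left,
      ← inner_sub_right, ← map_sub, h3]
  -- With `Si = (1 - T)⁻¹`, substituting `y = Si (C v + α)` and `x = -Si* N y` into `C* x = R v`
  -- gives `G v = -C* Si* N Si α`.
  let G : U →L[ℝ] U := R + C.adjoint ∘L Si.adjoint ∘L N ∘L Si ∘L C
  have hG : ∀ v, δ * ‖v‖ ^ 2 ≤ inner ℝ (G v) v := fun v => by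
    have : inner ℝ (G v) v = inner ℝ (R v) v + inner ℝ (N (Si (C v))) (Si (C v)) := by
      simp [G, inner_add_left, ContinuousLinearMap.adjoint_inner_left]
    rw [this]
    linarith [hR v, hN (Si (C v))]
  obtain ⟨v, hv⟩ := surjective_of_coercive G hδ hG (-C.adjoint (Si.adjoint (N (Si α))))
  refine ⟨-Si.adjoint (N (Si (C v + α))), Si (C v + α), v, ?_, ?_, ?_⟩
  · have := h2 (C v + α)
    rw [sub_eq_iff_eq_add'] at this
    rw [add_assoc]
    exact this
  · have := h4 (N (Si (C v + α)))
    rw [map_neg]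
    nth_rw 3 [← this]
    abel
  · simp only [G, _root_.add_apply, ContinuousLinearMap.comp_apply] at hv
    rw [map_neg, map_add, map_add, map_add, map_add, neg_add, ← hv]
    abel

/-- Critical points are unique. -/
theorem IsCritical.unique {T N : X →L[ℝ] X} (hT : ‖T‖ < 1) {C : U →L[ℝ] X} {R : U →L[ℝ] U} {α : X}
    (hN : ∀ y, 0 ≤ inner ℝ (N y) y) (hNs : ∀ y z, inner ℝ (N y) z = inner ℝ y (N z))
    {δ : ℝ} (hδ : 0 < δ) (hR : ∀ v, δ * ‖v‖ ^ 2 ≤ inner ℝ (R v) v)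
    (hRs : ∀ u v, inner ℝ (R u) v = inner ℝ u (R v))
    {x y x' y' : X} {v v' : U} (h : IsCritical T N C R α x y v)
    (h' : IsCritical T N C R α x' y' v') : x' = x ∧ y' = y ∧ v' = v := by
  have h1 := h.cost_ge hN hNs hR hRs h'.state
  have h2 := h'.cost_ge hN hNs hR hRs h.state
  -- Each critical point beats the other by `δ ‖v' - v‖²`; adding the two inequalities leaves `2 δ
  -- ‖v' - v‖² ≤ 0`.
  have h3 : ‖v' - v‖ ^ 2 = 0 := by
    rw [norm_sub_rev v v'] at h2
    have : 0 ≤ ‖v' - v‖ ^ 2 := sq_nonneg _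
    nlinarith
  have hv : v' = v := by simpa [sub_eq_zero] using h3
  subst hv
  have hy : y' = y := (existsUnique_eq_add_of_norm_lt_one T hT (C v' + α)).unique
    (by rw [← add_assoc]; exact h'.state) (by rw [← add_assoc]; exact h.state)
  subst hy
  refine ⟨(existsUnique_eq_add_of_norm_lt_one T.adjoint (by simpa using hT) (-N y')).unique
    ?_ ?_, rfl, rfl⟩
  · rw [← sub_eq_add_neg]; exact h'.costate
  · rw [← sub_eq_add_neg]; exact h.costate

end Abstract

/-! ### The predictable σ-algebra and its discounted measure -/

section Predictable

variable {Ω : Type*} {m0 : MeasurableSpace Ω}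

theorem past_le (ℱ : Filtration ℕ m0) : ∀ k, past ℱ k ≤ m0
  | 0 => bot_le
  | k + 1 => ℱ.le k

theorem past_le_succ (ℱ : Filtration ℕ m0) : ∀ k, past ℱ k ≤ past ℱ (k + 1)
  | 0 => bot_le
  | k + 1 => ℱ.mono k.le_succ

/-- Time and chance, with the σ-algebra of the sets whose section at every time `k` belongs to
`F_{k-1}`. -/
def Pred (_ : Filtration ℕ m0) : Type _ := ℕ × Ω

/-- The filtration is a phantom argument of `Pred` so that this structure can depend on it and does
not compete with the product σ-algebra on `ℕ × Ω`. -/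
instance (ℱ : Filtration ℕ m0) : MeasurableSpace (Pred ℱ) :=
  ⨅ k : ℕ, (past ℱ k).map (fun ω => ((k, ω) : ℕ × Ω))

/-- The point at time `k` and chance `ω`. -/
def slot (ℱ : Filtration ℕ m0) (k : ℕ) (ω : Ω) : Pred ℱ := (k, ω)

/-- A process as a function of time and chance. -/
def join (ℱ : Filtration ℕ m0) {E : Type*} (g : ℕ → Ω → E) (p : Pred ℱ) : E := g p.1 p.2

@[simp] theorem join_slot (ℱ : Filtration ℕ m0) {E : Type*} (g : ℕ → Ω → E) (k : ℕ) (ω : Ω) :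
    join ℱ g (slot ℱ k ω) = g k ω := rfl

theorem measurableSet_pred_iff {ℱ : Filtration ℕ m0} {s : Set (Pred ℱ)} :
    MeasurableSet s ↔ ∀ k, MeasurableSet[past ℱ k] (slot ℱ k ⁻¹' s) :=
  MeasurableSpace.measurableSet_iInf

theorem measurable_slot_past (ℱ : Filtration ℕ m0) (k : ℕ) : Measurable[past ℱ k] (slot ℱ k) :=
  fun _ hs => measurableSet_pred_iff.1 hs k

theorem measurable_slot (ℱ : Filtration ℕ m0) (k : ℕ) : Measurable (slot ℱ k) :=
  (measurable_slot_past ℱ k).mono (past_le ℱ k) le_rfl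

theorem measurable_join {ℱ : Filtration ℕ m0} {E : Type*} [MeasurableSpace E] {g : ℕ → Ω → E}
    (h : ∀ k, Measurable[past ℱ k] (g k)) : Measurable (join ℱ g) :=
  fun _ hs => measurableSet_pred_iff.2 fun k => h k hs

variable (P : Measure Ω) (ℱ : Filtration ℕ m0) (ρ : ℝ)

/-- The product of the discounted counting measure and `P` on the predictable sets. -/
def predMeasure : Measure (Pred ℱ) :=
  Measure.sum fun k : ℕ => ENNReal.ofReal (Real.exp (-ρ * k)) • P.map (slot ℱ k)

variable {P ℱ ρ}

theorem ofReal_exp_ne_zero (r : ℝ) : ENNReal.ofReal (Real.exp r) ≠ 0 := by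
  simp [Real.exp_pos]

theorem lintegral_predMeasure {f : Pred ℱ → ℝ≥0∞} (hf : Measurable f) :
    ∫⁻ p, f p ∂predMeasure P ℱ ρ
      = ∑' k : ℕ, ENNReal.ofReal (Real.exp (-ρ * k)) * ∫⁻ ω, f (slot ℱ k ω) ∂P := by
  simp only [predMeasure, lintegral_sum_measure, lintegral_smul_measure, smul_eq_mul]
  congr 1; ext k
  rw [lintegral_map hf (measurable_slot ℱ k)]

theorem ae_slot {q : Pred ℱ → Prop} (h : ∀ᵐ p ∂predMeasure P ℱ ρ, q p) (k : ℕ) :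
    ∀ᵐ ω ∂P, q (slot ℱ k ω) := by
  have h1 := Measure.ae_sum_iff.1 h k
  rw [Measure.ae_ennreal_smul_measure_iff (ofReal_exp_ne_zero _)] at h1
  exact ae_of_ae_map (measurable_slot ℱ k).aemeasurable h1

/-- All weights `exp(-ρ k)` are positive, so a predictable set is null exactly when its section at
every time is null. With `ae_slot`, this matches almost sure equality at each time with equality of
classes. -/
theorem ae_predMeasure {q : Pred ℱ → Prop} (hq : MeasurableSet {p | q p})
    (h : ∀ k, ∀ᵐ ω ∂P, q (slot ℱ k ω)) : ∀ᵐ p ∂predMeasure P ℱ ρ, q p := by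
  refine (Measure.ae_sum_iff' hq).2 fun k => ?_
  rw [Measure.ae_ennreal_smul_measure_iff (ofReal_exp_ne_zero _),
    ae_map_iff (measurable_slot ℱ k).aemeasurable hq]
  exact h k

theorem ae_eq_predMeasure_iff {E : Type*} [TopologicalSpace E] [TopologicalSpace.MetrizableSpace E]
    {f g : Pred ℱ → E} (hf : StronglyMeasurable f) (hg : StronglyMeasurable g) :
    f =ᵐ[predMeasure P ℱ ρ] g ↔ ∀ k, (fun ω => f (slot ℱ k ω)) =ᵐ[P] fun ω => g (slot ℱ k ω) :=
  ⟨fun h k => ae_slot h k, fun h => ae_predMeasure (hf.measurableSet_eq_fun hg) h⟩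

theorem hasSum_integral_predMeasure {f : Pred ℱ → ℝ} (hf : Integrable f (predMeasure P ℱ ρ)) :
    HasSum (fun k : ℕ => Real.exp (-ρ * k) * ∫ ω, f (slot ℱ k ω) ∂P)
      (∫ p, f p ∂predMeasure P ℱ ρ) := by
  have h : HasSum _ (∫ p, f p ∂predMeasure P ℱ ρ) := hasSum_integral_measure hf
  convert h using 2 with k
  have hk : AEStronglyMeasurable f (P.map (slot ℱ k)) := by
    have := (hf.1.mono_measure (Measure.le_sum
      (fun k : ℕ => ENNReal.ofReal (Real.exp (-ρ * k)) • P.map (slot ℱ k)) k)).aemeasurable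
    rw [aemeasurable_smul_measure_iff (ofReal_exp_ne_zero _)] at this
    exact this.aestronglyMeasurable
  rw [integral_smul_measure, integral_map (measurable_slot ℱ k).aemeasurable hk,
    ENNReal.toReal_ofReal (Real.exp_pos _).le, smul_eq_mul]

end Predictable

/-! ### `L^{2,ρ}` as a Hilbert space -/

section Space

variable {Ω : Type*} {m0 : MeasurableSpace Ω} {P : Measure Ω} {ℱ : Filtration ℕ m0} {ρ : ℝ}
  {p q : ℕ}

/-- Adapted to the past. -/
def IsPast (ℱ : Filtration ℕ m0) (g : ℕ → Ω → EuclideanSpace ℝ (Fin p)) : Prop :=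
  ∀ k, StronglyMeasurable[past ℱ k] (g k)

theorem IsPast.join {g : ℕ → Ω → EuclideanSpace ℝ (Fin p)} (h : IsPast ℱ g) :
    StronglyMeasurable (join ℱ g) :=
  (measurable_join fun k => (h k).measurable).stronglyMeasurable

/-- The square of the norm of a process in `L^{2,ρ}`. -/
def sqNorm (P : Measure Ω) (ρ : ℝ) (g : ℕ → Ω → EuclideanSpace ℝ (Fin p)) : ℝ≥0∞ :=
  ∫⁻ ω, ∑' k : ℕ, ENNReal.ofReal (Real.exp (-ρ * k)) * ‖g k ω‖ₑ ^ 2 ∂P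

theorem IsPast.sqNorm_eq_tsum {g : ℕ → Ω → EuclideanSpace ℝ (Fin p)} (h : IsPast ℱ g) :
    sqNorm P ρ g
      = ∑' k : ℕ, ENNReal.ofReal (Real.exp (-ρ * k)) * ∫⁻ ω, ‖g k ω‖ₑ ^ 2 ∂P := by
  have h1 : ∀ k, Measurable fun ω => ‖g k ω‖ₑ ^ 2 := fun k =>
    (((h k).mono (past_le ℱ k)).measurable.enorm.pow_const 2)
  rw [sqNorm, lintegral_tsum fun k => ((h1 k).const_mul _).aemeasurable]
  congr 1; ext k
  rw [lintegral_const_mul _ (h1 k)]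

theorem eLpNorm_two_sq {α E : Type*} {mα : MeasurableSpace α} [NormedAddCommGroup E]
    (μ : Measure α) (f : α → E) : eLpNorm f 2 μ ^ 2 = ∫⁻ a, ‖f a‖ₑ ^ 2 ∂μ := by
  rw [eLpNorm_eq_lintegral_rpow_enorm_toReal (by simp) (by simp), ← ENNReal.rpow_natCast,
    ← ENNReal.rpow_mul]
  simp

theorem IsPast.sqNorm_eq {g : ℕ → Ω → EuclideanSpace ℝ (Fin p)} (h : IsPast ℱ g) :
    sqNorm P ρ g = eLpNorm (BLQ.join ℱ g) 2 (predMeasure P ℱ ρ) ^ 2 := by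
  rw [h.sqNorm_eq_tsum, eLpNorm_two_sq,
    lintegral_predMeasure (h.join.measurable.enorm.pow_const 2)]
  rfl

/-- By Tonelli, the expectation of the discounted series is the square of the `L²` norm for
`predMeasure`; completeness of `L^{2,ρ}` comes from here. -/
theorem isL2_iff {g : ℕ → Ω → EuclideanSpace ℝ (Fin p)} :
    IsL2 P ℱ ρ g ↔ IsPast ℱ g ∧ MemLp (join ℱ g) 2 (predMeasure P ℱ ρ) := by
  constructor
  · intro h
    have hp : IsPast ℱ g := h.adapted
    refine ⟨hp, hp.join.aestronglyMeasurable, ?_⟩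
    have : sqNorm P ρ g < ∞ := h.finite
    rw [hp.sqNorm_eq] at this
    simpa using this
  · rintro ⟨hp, h⟩
    refine ⟨hp, ?_⟩
    change sqNorm P ρ g < ∞
    rw [hp.sqNorm_eq]
    exact ENNReal.pow_lt_top h.2

/-- The Hilbert space of the classes of processes in `L^{2,ρ}`. -/
abbrev H (P : Measure Ω) (ℱ : Filtration ℕ m0) (ρ : ℝ) (p : ℕ) :=
  Lp (EuclideanSpace ℝ (Fin p)) 2 (predMeasure P ℱ ρ)

/-- The class of a process. -/
def IsL2.toH {g : ℕ → Ω → EuclideanSpace ℝ (Fin p)} (h : IsL2 P ℱ ρ g) : H P ℱ ρ p :=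
  (isL2_iff.1 h).2.toLp

/-- A process in a given class. -/
def proc (f : H P ℱ ρ p) : ℕ → Ω → EuclideanSpace ℝ (Fin p) := fun k ω => f (slot ℱ k ω)

theorem isPast_proc (f : H P ℱ ρ p) : IsPast ℱ (proc f) := fun k =>
  (Lp.stronglyMeasurable f).comp_measurable (measurable_slot_past ℱ k)

theorem isL2_proc (f : H P ℱ ρ p) : IsL2 P ℱ ρ (proc f) :=
  isL2_iff.2 ⟨isPast_proc f, Lp.memLp f⟩

theorem same_proc_toH {g : ℕ → Ω → EuclideanSpace ℝ (Fin p)} (h : IsL2 P ℱ ρ g) :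
    Same P (proc h.toH) g := fun k => ae_slot (isL2_iff.1 h).2.coeFn_toLp k

theorem same_proc_iff {f g : H P ℱ ρ p} : Same P (proc f) (proc g) ↔ f = g := by
  constructor
  · intro h
    exact Lp.ext ((ae_eq_predMeasure_iff (Lp.stronglyMeasurable f) (Lp.stronglyMeasurable g)).2 h)
  · rintro rfl k
    rfl

theorem Same.symm {g h : ℕ → Ω → EuclideanSpace ℝ (Fin p)} (e : Same P g h) : Same P h g :=
  fun k => (e k).symm

theorem Same.trans {f g h : ℕ → Ω → EuclideanSpace ℝ (Fin p)} (e : Same P f g) (e' : Same P g h) :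
    Same P f h := fun k => (e k).trans (e' k)

theorem toH_eq_iff {g g' : ℕ → Ω → EuclideanSpace ℝ (Fin p)} {h : IsL2 P ℱ ρ g}
    {h' : IsL2 P ℱ ρ g'} : h.toH = h'.toH ↔ Same P g g' := by
  rw [← same_proc_iff]
  exact ⟨fun e => ((same_proc_toH h).symm.trans e).trans (same_proc_toH h'),
    fun e => ((same_proc_toH h).trans e).trans (same_proc_toH h').symm⟩

theorem same_proc_add (f g : H P ℱ ρ p) : Same P (proc (f + g)) (proc f + proc g) :=
  fun k => ae_slot (Lp.coeFn_add f g) k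

theorem same_proc_sub (f g : H P ℱ ρ p) : Same P (proc (f - g)) (proc f - proc g) :=
  fun k => ae_slot (Lp.coeFn_sub f g) k

theorem same_proc_smul (r : ℝ) (f : H P ℱ ρ p) : Same P (proc (r • f)) (r • proc f) :=
  fun k => ae_slot (Lp.coeFn_smul r f) k

theorem IsL2.enorm_toH_sq {g : ℕ → Ω → EuclideanSpace ℝ (Fin p)} (h : IsL2 P ℱ ρ g) :
    ‖h.toH‖ₑ ^ 2 = sqNorm P ρ g := by
  rw [IsPast.sqNorm_eq (ℱ := ℱ) h.adapted, IsL2.toH, Lp.enorm_toLp]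

theorem enorm_sq_eq (f : H P ℱ ρ p) : ‖f‖ₑ ^ 2 = sqNorm P ρ (proc f) := by
  rw [← (isL2_proc f).enorm_toH_sq]
  congr 2
  rw [← same_proc_iff]
  exact (same_proc_toH _).symm

theorem hasSum_inner (f g : H P ℱ ρ p) :
    HasSum (fun k : ℕ => Real.exp (-ρ * k) * ∫ ω, inner ℝ (proc f k ω) (proc g k ω) ∂P)
      (inner ℝ f g) := by
  rw [L2.inner_def]
  exact hasSum_integral_predMeasure (L2.integrable_inner f g)

theorem same_zero_of_sqNorm_eq_zero {g : ℕ → Ω → EuclideanSpace ℝ (Fin p)} (h : IsPast ℱ g)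
    (h0 : sqNorm P ρ g = 0) : Same P g 0 := by
  intro k
  rw [h.sqNorm_eq_tsum, ENNReal.tsum_eq_zero] at h0
  have h1 : ∫⁻ ω, ‖g k ω‖ₑ ^ 2 ∂P = 0 :=
    (mul_eq_zero.1 (h0 k)).resolve_left (ofReal_exp_ne_zero _)
  rw [lintegral_eq_zero_iff
    (((h k).mono (past_le ℱ k)).measurable.enorm.pow_const 2)] at h1
  filter_upwards [h1] with ω hω
  simpa using hω

theorem IsPast.sub {g h : ℕ → Ω → EuclideanSpace ℝ (Fin p)} (hg : IsPast ℱ g) (hh : IsPast ℱ h) :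
    IsPast ℱ (g - h) := fun k => (hg k).sub (hh k)

theorem IsPast.add {g h : ℕ → Ω → EuclideanSpace ℝ (Fin p)} (hg : IsPast ℱ g) (hh : IsPast ℱ h) :
    IsPast ℱ (g + h) := fun k => (hg k).add (hh k)

theorem IsPast.smul {g : ℕ → Ω → EuclideanSpace ℝ (Fin p)} (hg : IsPast ℱ g) (r : ℝ) :
    IsPast ℱ (r • g) := fun k => (hg k).const_smul r

/-- A linear map on processes that respects the past and is bounded by `c` in `L^{2,ρ}`. -/
structure IsBoundedOp (P : Measure Ω) (ℱ : Filtration ℕ m0) (ρ c : ℝ)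
    (Φ : (ℕ → Ω → EuclideanSpace ℝ (Fin p)) →ₗ[ℝ] (ℕ → Ω → EuclideanSpace ℝ (Fin q))) : Prop where
  nonneg : 0 ≤ c
  isPast : ∀ g, IsPast ℱ g → IsPast ℱ (Φ g)
  bound : ∀ g, IsPast ℱ g → sqNorm P ρ (Φ g) ≤ ENNReal.ofReal (c ^ 2) * sqNorm P ρ g

namespace IsBoundedOp

variable {c : ℝ} {Φ : (ℕ → Ω → EuclideanSpace ℝ (Fin p)) →ₗ[ℝ] (ℕ → Ω → EuclideanSpace ℝ (Fin q))}

theorem isL2 (hΦ : IsBoundedOp P ℱ ρ c Φ)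
    {g : ℕ → Ω → EuclideanSpace ℝ (Fin p)} (hg : IsL2 P ℱ ρ g) : IsL2 P ℱ ρ (Φ g) :=
  ⟨hΦ.isPast g hg.adapted, (hΦ.bound g hg.adapted).trans_lt
    (ENNReal.mul_lt_top ENNReal.ofReal_lt_top hg.finite)⟩

/-- The difference of the two processes has seminorm zero, and boundedness passes this on to its
image. This is what lets `Φ` descend to classes. -/
theorem congr (hΦ : IsBoundedOp P ℱ ρ c Φ)
    {g h : ℕ → Ω → EuclideanSpace ℝ (Fin p)}
    (hg : IsPast ℱ g) (hh : IsPast ℱ h)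
    (e : Same P g h) : Same P (Φ g) (Φ h) := by
  have h0 : sqNorm P ρ (g - h) = 0 := by
    rw [(hg.sub hh).sqNorm_eq_tsum, ENNReal.tsum_eq_zero]
    intro k
    have : ∫⁻ ω, ‖(g - h) k ω‖ₑ ^ 2 ∂P = ∫⁻ _, 0 ∂P := by
      refine lintegral_congr_ae ?_
      filter_upwards [e k] with ω hω
      simp [hω]
    rw [this]; simp
  have h1 : sqNorm P ρ (Φ (g - h)) = 0 := by
    simpa [h0] using hΦ.bound _ (hg.sub hh)
  have h2 := same_zero_of_sqNorm_eq_zero (hΦ.isPast _ (hg.sub hh)) h1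
  intro k
  filter_upwards [h2 k] with ω hω
  rw [map_sub] at hω
  exact sub_eq_zero.1 hω

/-- The operator on `L^{2,ρ}` induced by a bounded linear map on processes. -/
def op (hΦ : IsBoundedOp P ℱ ρ c Φ) : H P ℱ ρ p →L[ℝ] H P ℱ ρ q :=
  LinearMap.mkContinuous
    { toFun := fun f => (hΦ.isL2 (isL2_proc f)).toH
      map_add' := fun f g => by
        rw [← same_proc_iff]
        refine (same_proc_toH _).trans (Same.trans ?_ (same_proc_add _ _).symm)
        refine (hΦ.congr (isPast_proc _) ((isPast_proc _).add (isPast_proc _))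
          (same_proc_add f g)).trans ?_
        rw [map_add]
        exact fun k => ((same_proc_toH _ k).symm.add (same_proc_toH _ k).symm)
      map_smul' := fun r f => by
        rw [← same_proc_iff]
        refine (same_proc_toH _).trans (Same.trans ?_ (same_proc_smul _ _).symm)
        refine (hΦ.congr (isPast_proc _) ((isPast_proc _).smul r) (same_proc_smul r f)).trans ?_
        rw [map_smul]
        exact fun k => ((same_proc_toH _ k).symm.const_smul r) } c (fun f => by
      have h1 : ‖(hΦ.isL2 (isL2_proc f)).toH‖ₑ ^ 2 ≤ (ENNReal.ofReal c * ‖f‖ₑ) ^ 2 := by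
        rw [IsL2.enorm_toH_sq, mul_pow, enorm_sq_eq, ← ENNReal.ofReal_pow hΦ.nonneg]
        exact hΦ.bound _ (isPast_proc f)
      have h2 := (ENNReal.pow_le_pow_left_iff two_ne_zero).1 h1
      have h3 := ENNReal.toReal_mono (by finiteness) h2
      simpa [ENNReal.toReal_mul, hΦ.nonneg] using h3)

theorem norm_op_le (hΦ : IsBoundedOp P ℱ ρ c Φ) : ‖hΦ.op‖ ≤ c := LinearMap.mkContinuous_norm_le _ hΦ.nonneg _

theorem same_proc_op (hΦ : IsBoundedOp P ℱ ρ c Φ) (f : H P ℱ ρ p) : Same P (proc (hΦ.op f)) (Φ (proc f)) :=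
  same_proc_toH (hΦ.isL2 (isL2_proc f))

end IsBoundedOp

end Space

/-! ### Matrices acting on Euclidean space -/

section Matrices

variable {p q : ℕ}

theorem matNorm_sq (A : Matrix (Fin p) (Fin q) ℝ) : matNorm A ^ 2 = ∑ i, ∑ j, A i j ^ 2 := by
  have h : (A * Aᵀ).trace = ∑ i, ∑ j, A i j ^ 2 := by
    simp [Matrix.trace, Matrix.mul_apply, sq]
  rw [matNorm, h, Real.sq_sqrt]
  positivity

theorem matNorm_nonneg (A : Matrix (Fin p) (Fin q) ℝ) : 0 ≤ matNorm A := Real.sqrt_nonneg _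

theorem matNorm_transpose (A : Matrix (Fin p) (Fin q) ℝ) : matNorm Aᵀ = matNorm A := by
  rw [matNorm, matNorm, transpose_transpose, trace_mul_comm]

/-- Cauchy–Schwarz in each row: the Frobenius norm dominates the operator norm. -/
theorem norm_toEuclideanLin_le (A : Matrix (Fin p) (Fin q) ℝ) (x : EuclideanSpace ℝ (Fin q)) :
    ‖toEuclideanLin A x‖ ≤ matNorm A * ‖x‖ := by
  refine le_of_sq_le_sq ?_ (mul_nonneg (matNorm_nonneg A) (norm_nonneg x))
  rw [mul_pow, matNorm_sq, EuclideanSpace.real_norm_sq_eq, EuclideanSpace.real_norm_sq_eq,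
    Finset.sum_mul]
  refine Finset.sum_le_sum fun i _ => ?_
  simpa [Matrix.mulVec, dotProduct] using Finset.sum_mul_sq_le_sq_mul_sq Finset.univ (A i) x

theorem inner_toEuclideanLin_left (A : Matrix (Fin p) (Fin q) ℝ) (x : EuclideanSpace ℝ (Fin q))
    (y : EuclideanSpace ℝ (Fin p)) :
    inner ℝ (toEuclideanLin A x) y = inner ℝ x (toEuclideanLin Aᵀ y) := by
  rw [← conjTranspose_eq_transpose_of_trivial, toEuclideanLin_conjTranspose_eq_adjoint,
    LinearMap.adjoint_inner_right]

theorem toEuclideanLin_mul_apply {r : ℕ} (A : Matrix (Fin p) (Fin q) ℝ)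
    (B : Matrix (Fin q) (Fin r) ℝ) (x : EuclideanSpace ℝ (Fin r)) :
    toEuclideanLin (A * B) x = toEuclideanLin A (toEuclideanLin B x) := by
  simp [toLpLin_apply]

theorem toEuclideanLin_one_apply (x : EuclideanSpace ℝ (Fin p)) :
    toEuclideanLin (1 : Matrix (Fin p) (Fin p) ℝ) x = x := by
  simp

theorem inner_toEuclideanLin_nonneg {A : Matrix (Fin p) (Fin p) ℝ} (hA : A.PosSemidef)
    (x : EuclideanSpace ℝ (Fin p)) : 0 ≤ inner ℝ (toEuclideanLin A x) x := by
  have := (isPositive_toEuclideanLin_iff.2 hA).inner_nonneg_left x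
  simpa using this

theorem continuous_toEuclideanLin :
    Continuous fun z : Matrix (Fin p) (Fin q) ℝ × EuclideanSpace ℝ (Fin q) =>
      toEuclideanLin z.1 z.2 := by
  simp only [toLpLin_apply]
  exact (PiLp.continuous_toLp 2 _).comp
    (continuous_fst.matrix_mulVec ((PiLp.continuous_ofLp 2 _).comp continuous_snd))

end Matrices

/-! ### Multiplication operators by bounded predictable matrices -/

section Multiplication

variable {Ω : Type*} {m0 : MeasurableSpace Ω} {P : Measure Ω} {ℱ : Filtration ℕ m0} {ρ : ℝ}
  {p q : ℕ}

/-- Multiplication of a process by a matrix-valued process. -/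
def mulMap (A : ℕ → Ω → Matrix (Fin p) (Fin q) ℝ) :
    (ℕ → Ω → EuclideanSpace ℝ (Fin q)) →ₗ[ℝ] (ℕ → Ω → EuclideanSpace ℝ (Fin p)) where
  toFun g k ω := toEuclideanLin (A k ω) (g k ω)
  map_add' g h := by ext k ω : 2; simp
  map_smul' r g := by ext k ω : 2; simp

theorem IsLinf.ae_matNorm_le {A : ℕ → Ω → Matrix (Fin p) (Fin q) ℝ} (hA : IsLinf P ℱ A) (k : ℕ) :
    ∀ᵐ ω ∂P, matNorm (A k ω) ≤ (linfNorm P A).toReal := by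
  filter_upwards [ae_le_essSup (μ := P) (f := fun ω => ENNReal.ofReal (matNorm (A k ω)))] with ω hω
  rw [← ENNReal.ofReal_le_iff_le_toReal hA.bounded.ne]
  exact hω.trans (le_iSup (fun k => essSup (fun ω => ENNReal.ofReal (matNorm (A k ω))) P) k)

theorem isLinf_of_ae_matNorm_le {A : ℕ → Ω → Matrix (Fin p) (Fin q) ℝ}
    (h : ∀ k, StronglyMeasurable[past ℱ k] (A k)) (a : ℝ)
    (ha : ∀ k, ∀ᵐ ω ∂P, matNorm (A k ω) ≤ a) : IsLinf P ℱ A := by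
  refine ⟨h, lt_of_le_of_lt (iSup_le fun k => ?_) (ENNReal.ofReal_lt_top (r := a))⟩
  refine essSup_le_of_ae_le _ ?_
  filter_upwards [ha k] with ω hω
  exact ENNReal.ofReal_le_ofReal hω

theorem IsLinf.transpose {A : ℕ → Ω → Matrix (Fin p) (Fin q) ℝ} (hA : IsLinf P ℱ A) :
    IsLinf P ℱ fun k ω => (A k ω)ᵀ := by
  refine isLinf_of_ae_matNorm_le (fun k => ?_) (linfNorm P A).toReal fun k => ?_
  · exact (continuous_id.matrix_transpose).comp_stronglyMeasurable (hA.adapted k)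
  · simpa only [matNorm_transpose] using hA.ae_matNorm_le k

theorem sqNorm_le_of_ae_le {g : ℕ → Ω → EuclideanSpace ℝ (Fin p)}
    {h : ℕ → Ω → EuclideanSpace ℝ (Fin q)} (hg : IsPast ℱ g) (hh : IsPast ℱ h) {c : ℝ} (hc : 0 ≤ c)
    (hle : ∀ k, ∀ᵐ ω ∂P, ‖h k ω‖ ≤ c * ‖g k ω‖) :
    sqNorm P ρ h ≤ ENNReal.ofReal (c ^ 2) * sqNorm P ρ g := by
  rw [hg.sqNorm_eq_tsum, hh.sqNorm_eq_tsum, ← ENNReal.tsum_mul_left]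
  refine ENNReal.tsum_le_tsum fun k => ?_
  rw [mul_left_comm]
  gcongr
  rw [← lintegral_const_mul _ (((hg k).mono (past_le ℱ k)).measurable.enorm.pow_const 2)]
  refine lintegral_mono_ae ?_
  filter_upwards [hle k] with ω hω
  rw [ENNReal.ofReal_pow hc, ← mul_pow]
  gcongr
  rw [← ofReal_norm, ← ofReal_norm, ← ENNReal.ofReal_mul hc]
  exact ENNReal.ofReal_le_ofReal hω

theorem IsPast.mulMap {A : ℕ → Ω → Matrix (Fin p) (Fin q) ℝ}
    (hA : ∀ k, StronglyMeasurable[past ℱ k] (A k)) {g : ℕ → Ω → EuclideanSpace ℝ (Fin q)}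
    (hg : IsPast ℱ g) : IsPast ℱ (mulMap A g) := fun k =>
  continuous_toEuclideanLin.comp_stronglyMeasurable ((hA k).prodMk (hg k))

theorem IsLinf.isBoundedOp {A : ℕ → Ω → Matrix (Fin p) (Fin q) ℝ} (hA : IsLinf P ℱ A) :
    IsBoundedOp P ℱ ρ (linfNorm P A).toReal (mulMap A) := by
  refine ⟨ENNReal.toReal_nonneg, fun g hg => hg.mulMap hA.adapted, fun g hg =>
    sqNorm_le_of_ae_le hg (hg.mulMap hA.adapted) ENNReal.toReal_nonneg fun k => ?_⟩
  filter_upwards [hA.ae_matNorm_le k] with ω hω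
  exact (norm_toEuclideanLin_le _ _).trans (by gcongr)

/-- Multiplication by an essentially bounded matrix-valued process, as an operator. -/
def IsLinf.mulOp {A : ℕ → Ω → Matrix (Fin p) (Fin q) ℝ} (hA : IsLinf P ℱ A) (ρ : ℝ) :
    H P ℱ ρ q →L[ℝ] H P ℱ ρ p := (hA.isBoundedOp (ρ := ρ)).op

theorem IsLinf.norm_mulOp_le {A : ℕ → Ω → Matrix (Fin p) (Fin q) ℝ} (hA : IsLinf P ℱ A) :
    ‖hA.mulOp ρ‖ ≤ (linfNorm P A).toReal := hA.isBoundedOp.norm_op_le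

theorem IsLinf.proc_mulOp {A : ℕ → Ω → Matrix (Fin p) (Fin q) ℝ} (hA : IsLinf P ℱ A)
    (f : H P ℱ ρ q) (k : ℕ) :
    ∀ᵐ ω ∂P, proc (hA.mulOp ρ f) k ω = toEuclideanLin (A k ω) (proc f k ω) :=
  hA.isBoundedOp.same_proc_op f k

/-- Inner products are sums over time of expectations, so pointwise identities suffice. The
dimensions may differ, as the adjoint of a rectangular multiplier requires. -/
theorem inner_eq_inner {f : H P ℱ ρ p} {f' : H P ℱ ρ p} {g g' : H P ℱ ρ q}
    (h : ∀ k, ∀ᵐ ω ∂P, (inner ℝ (proc f k ω) (proc f' k ω) : ℝ)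
      = inner ℝ (proc g k ω) (proc g' k ω)) : (inner ℝ f f' : ℝ) = inner ℝ g g' := by
  refine (hasSum_inner f f').unique ?_
  convert hasSum_inner g g' using 3 with k
  exact integral_congr_ae (h k)

theorem IsLinf.adjoint_mulOp {A : ℕ → Ω → Matrix (Fin p) (Fin q) ℝ} (hA : IsLinf P ℱ A) :
    (hA.mulOp ρ).adjoint = hA.transpose.mulOp ρ := by
  refine ContinuousLinearMap.ext fun f => ext_inner_left ℝ fun g => ?_
  rw [ContinuousLinearMap.adjoint_inner_right]
  refine inner_eq_inner fun k => ?_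
  filter_upwards [hA.proc_mulOp g k, hA.transpose.proc_mulOp f k] with ω h1 h2
  rw [h1, h2, inner_toEuclideanLin_left]

theorem IsLinf.mulOp_symmetric {A : ℕ → Ω → Matrix (Fin p) (Fin p) ℝ} (hA : IsLinf P ℱ A)
    (hs : ∀ k, ∀ᵐ ω ∂P, (A k ω)ᵀ = A k ω) (f g : H P ℱ ρ p) :
    (inner ℝ (hA.mulOp ρ f) g : ℝ) = inner ℝ f (hA.mulOp ρ g) := by
  refine inner_eq_inner fun k => ?_
  filter_upwards [hA.proc_mulOp g k, hA.proc_mulOp f k, hs k] with ω h1 h2 h3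
  rw [h1, h2, inner_toEuclideanLin_left, h3]

theorem IsLinf.mul_sq_norm_le_inner_mulOp {A : ℕ → Ω → Matrix (Fin p) (Fin p) ℝ}
    (hA : IsLinf P ℱ A) {δ : ℝ} (hs : ∀ k, ∀ᵐ ω ∂P, (A k ω - δ • 1).PosSemidef)
    (f : H P ℱ ρ p) : δ * ‖f‖ ^ 2 ≤ inner ℝ (hA.mulOp ρ f) f := by
  rw [← sub_nonneg, ← real_inner_self_eq_norm_sq, ← real_inner_smul_left, ← inner_sub_left]
  refine (hasSum_inner (hA.mulOp ρ f - δ • f) f).nonneg fun k =>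
    mul_nonneg (Real.exp_pos _).le (integral_nonneg_of_ae ?_)
  filter_upwards [same_proc_sub (hA.mulOp ρ f) (δ • f) k, same_proc_smul δ f k,
    hA.proc_mulOp f k, hs k] with ω h1 h2 h3 h4
  rw [h1]
  simp only [Pi.sub_apply, Pi.smul_apply, Pi.zero_apply] at h2 ⊢
  rw [h2, h3]
  simpa [toEuclideanLin_one_apply] using inner_toEuclideanLin_nonneg h4 (proc f k ω)

theorem IsLinf.inner_mulOp_nonneg {A : ℕ → Ω → Matrix (Fin p) (Fin p) ℝ}
    (hA : IsLinf P ℱ A) (hs : ∀ k, ∀ᵐ ω ∂P, (A k ω).PosSemidef)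
    (f : H P ℱ ρ p) : 0 ≤ inner ℝ (hA.mulOp ρ f) f := by
  simpa using hA.mul_sq_norm_le_inner_mulOp (δ := 0) (by simpa using hs) f

end Multiplication

/-! ### Weighted delays and conditional expectations of the next value -/

section Shift

variable {Ω : Type*} {m0 : MeasurableSpace Ω} {P : Measure Ω} {ℱ : Filtration ℕ m0} {ρ : ℝ}
  {p q : ℕ} {φ : ℕ → Ω → ℝ}

/-- An adapted real process with conditional second moment one. -/
structure IsUnitWeight (P : Measure Ω) (ℱ : Filtration ℕ m0) (φ : ℕ → Ω → ℝ) : Prop where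
  adapted : ∀ k, StronglyMeasurable[ℱ k] (φ k)
  memLp : ∀ k, MemLp (φ k) 2 P
  setLIntegral : ∀ k s, MeasurableSet[past ℱ k] s → ∫⁻ ω in s, ‖φ k ω‖ₑ ^ 2 ∂P = P s

/-- The weight `1` produces `y'` and the weight `w` produces `z'`; both are treated by the same
argument. -/
theorem isUnitWeight_one [IsFiniteMeasure P] : IsUnitWeight P ℱ fun _ _ => 1 :=
  ⟨fun _ => stronglyMeasurable_const, fun _ => memLp_const 1, fun k s _ => by simp⟩

theorem IsNoise.isUnitWeight [IsProbabilityMeasure P] (h : IsNoise P ℱ φ) :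
    IsUnitWeight P ℱ φ := by
  refine ⟨h.adapted, h.sqIntegrable, fun k s hs => ?_⟩
  have hi : Integrable (fun ω => φ k ω ^ 2) P := (h.sqIntegrable k).integrable_sq
  have h1 : ∫ ω in s, φ k ω ^ 2 ∂P = P.real s := by
    rw [← setIntegral_condExp (past_le ℱ k) hi hs,
      setIntegral_congr_ae (past_le ℱ k s hs) ((h.condVar k).mono fun ω e _ => e)]
    simp
  have h2 := ofReal_integral_eq_lintegral_ofReal hi.integrableOn
    (μ := P.restrict s) (ae_of_all _ fun ω => sq_nonneg (φ k ω))
  rw [h1, ofReal_measureReal] at h2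
  rw [h2]
  congr 1; ext ω
  rw [← enorm_pow, Real.enorm_of_nonneg (sq_nonneg _)]

/-- The measures `|φ_k|² dP` and `dP` agree on `F_{k-1}`, hence give equal integrals to functions
measurable for it. -/
theorem IsUnitWeight.lintegral_mul (hφ : IsUnitWeight P ℱ φ) (k : ℕ) {f : Ω → ℝ≥0∞}
    (hf : Measurable[past ℱ k] f) : ∫⁻ ω, ‖φ k ω‖ₑ ^ 2 * f ω ∂P = ∫⁻ ω, f ω ∂P := by
  have hm : Measurable fun ω => ‖φ k ω‖ₑ ^ 2 :=
    ((hφ.adapted k).mono (ℱ.le k)).measurable.enorm.pow_const 2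
  have h1 : (P.withDensity fun ω => ‖φ k ω‖ₑ ^ 2).trim (past_le ℱ k) = P.trim (past_le ℱ k) := by
    refine @Measure.ext _ (past ℱ k) _ _ fun s hs => ?_
    rw [trim_measurableSet_eq _ hs, trim_measurableSet_eq _ hs,
      withDensity_apply _ (past_le ℱ k s hs), hφ.setLIntegral k s hs]
  rw [← lintegral_trim (past_le ℱ k) hf, ← h1, lintegral_trim (past_le ℱ k) hf,
    lintegral_withDensity_eq_lintegral_mul _ hm (hf.mono (past_le ℱ k) le_rfl)]
  rfl

/-- The process `φ_k g_k` delayed by one step. -/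
def shiftMap (p : ℕ) (φ : ℕ → Ω → ℝ) :
    (ℕ → Ω → EuclideanSpace ℝ (Fin p)) →ₗ[ℝ] (ℕ → Ω → EuclideanSpace ℝ (Fin p)) where
  toFun g
    | 0 => 0
    | k + 1 => fun ω => φ k ω • g k ω
  map_add' g h := by
    ext k ω : 2
    cases k <;> simp
  map_smul' r g := by
    ext k ω : 2
    cases k <;> simp [smul_comm r]

/-- The weight lets `E|φ_k g_k|² = E|g_k|²`, and moving from time `k` to `k + 1` costs a discount
`exp(-ρ)`, the square of the constant. The bound is in fact an equality. -/
theorem IsUnitWeight.isBoundedOp (hφ : IsUnitWeight P ℱ φ) :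
    IsBoundedOp P ℱ ρ (Real.exp (-ρ / 2)) (shiftMap p φ) := by
  have hp : ∀ g : ℕ → Ω → EuclideanSpace ℝ (Fin p), IsPast ℱ g → IsPast ℱ (shiftMap p φ g) := by
    intro g hg k
    cases k with
    | zero => exact stronglyMeasurable_zero
    | succ k => exact (hφ.adapted k).smul ((hg k).mono (past_le_succ ℱ k))
  refine ⟨(Real.exp_pos _).le, hp, fun g hg => le_of_eq ?_⟩
  rw [hg.sqNorm_eq_tsum, (hp g hg).sqNorm_eq_tsum, tsum_eq_zero_add' ENNReal.summable,
    ← ENNReal.tsum_mul_left]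
  have h0 : ∫⁻ ω, ‖shiftMap p φ g 0 ω‖ₑ ^ 2 ∂P = 0 := by simp [shiftMap]
  rw [h0, mul_zero, zero_add]
  congr 1; ext k
  have h1 : ∫⁻ ω, ‖shiftMap p φ g (k + 1) ω‖ₑ ^ 2 ∂P = ∫⁻ ω, ‖g k ω‖ₑ ^ 2 ∂P := by
    refine Eq.trans ?_
      (hφ.lintegral_mul k ((measurable_enorm.pow_const 2).comp (hg k).measurable))
    simp [shiftMap, enorm_smul, mul_pow]
  rw [h1, ← mul_assoc, ← ENNReal.ofReal_mul (sq_nonneg _), ← Real.exp_nat_mul, ← Real.exp_add]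
  congr 3
  push_cast; ring

/-- The delay with weight `φ` as an operator. -/
def IsUnitWeight.shiftOp (hφ : IsUnitWeight P ℱ φ) (ρ : ℝ) (p : ℕ) : H P ℱ ρ p →L[ℝ] H P ℱ ρ p :=
  (hφ.isBoundedOp (ρ := ρ) (p := p)).op

theorem IsUnitWeight.proc_shiftOp_zero (hφ : IsUnitWeight P ℱ φ) (f : H P ℱ ρ p) :
    ∀ᵐ ω ∂P, proc (hφ.shiftOp ρ p f) 0 ω = 0 :=
  hφ.isBoundedOp.same_proc_op f 0

theorem IsUnitWeight.proc_shiftOp_succ (hφ : IsUnitWeight P ℱ φ) (f : H P ℱ ρ p) (k : ℕ) :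
    ∀ᵐ ω ∂P, proc (hφ.shiftOp ρ p f) (k + 1) ω = φ k ω • proc f k ω :=
  hφ.isBoundedOp.same_proc_op f (k + 1)

/-- The conditional expectation of the product of `φ_k` and the next value, as an operator. -/
def IsUnitWeight.nextOp (hφ : IsUnitWeight P ℱ φ) (ρ : ℝ) (p : ℕ) : H P ℱ ρ p →L[ℝ] H P ℱ ρ p :=
  Real.exp ρ • (hφ.shiftOp ρ p).adjoint

theorem IsUnitWeight.norm_nextOp_le (hφ : IsUnitWeight P ℱ φ) :
    ‖hφ.nextOp ρ p‖ ≤ Real.exp (ρ / 2) := by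
  rw [nextOp, norm_smul, Real.norm_of_nonneg (Real.exp_pos _).le,
    LinearIsometryEquiv.norm_map]
  refine (mul_le_mul_of_nonneg_left hφ.isBoundedOp.norm_op_le (Real.exp_pos _).le).trans_eq ?_
  rw [← Real.exp_add]
  ring_nf

theorem IsUnitWeight.adjoint_nextOp (hφ : IsUnitWeight P ℱ φ) :
    (hφ.nextOp ρ p).adjoint = Real.exp ρ • hφ.shiftOp ρ p := by
  simp [nextOp]

theorem IsL2.memLp {g : ℕ → Ω → EuclideanSpace ℝ (Fin p)} (h : IsL2 P ℱ ρ g) (k : ℕ) :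
    MemLp (g k) 2 P := by
  refine ⟨((h.adapted k).mono (past_le ℱ k)).aestronglyMeasurable, ?_⟩
  have h1 : sqNorm P ρ g < ∞ := h.finite
  rw [IsPast.sqNorm_eq_tsum (ℱ := ℱ) h.adapted] at h1
  have h2 := (ENNReal.le_tsum k).trans_lt h1
  rw [← eLpNorm_two_sq] at h2
  have h3 := ENNReal.lt_top_of_mul_ne_top_right h2.ne (ofReal_exp_ne_zero _)
  simpa using h3

theorem isL2_single [IsFiniteMeasure P] (k : ℕ) {s : Set Ω} (hs : MeasurableSet[past ℱ k] s)
    (c : EuclideanSpace ℝ (Fin p)) :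
    IsL2 P ℱ ρ (Pi.single k (s.indicator fun _ => c)) := by
  have hp : IsPast ℱ (Pi.single k (s.indicator fun _ => c)) := by
    intro j
    by_cases hj : j = k
    · subst hj
      rw [Pi.single_eq_same]
      exact stronglyMeasurable_const.indicator hs
    · rw [Pi.single_eq_of_ne hj]
      exact stronglyMeasurable_zero
  refine ⟨hp, ?_⟩
  change sqNorm P ρ _ < ∞
  rw [hp.sqNorm_eq_tsum, tsum_eq_single k]
  · rw [Pi.single_eq_same, ← eLpNorm_two_sq]
    exact ENNReal.mul_lt_top ENNReal.ofReal_lt_top (ENNReal.pow_lt_top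
      ((memLp_const c).indicator (past_le ℱ k s hs)).2)
  · intro j hj
    simp [Pi.single_eq_of_ne hj]

/-- Testing the adjoint relation against `1_s c` placed at time `k`, with `s` in `F_{k-1}`, gives
the identity of integrals over `s` that characterizes the conditional expectation. -/
theorem IsUnitWeight.proc_nextOp [IsFiniteMeasure P] (hφ : IsUnitWeight P ℱ φ) (y : H P ℱ ρ p)
    (k : ℕ) : proc (hφ.nextOp ρ p y) k
      =ᵐ[P] P[fun ω => φ k ω • proc y (k + 1) ω | past ℱ k] := by
  have hy : Integrable (fun ω => φ k ω • proc y (k + 1) ω) P :=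
    memLp_one_iff_integrable.1 (((isL2_proc y).memLp (k + 1)).smul (hφ.memLp k))
  have hD : Integrable (proc (hφ.nextOp ρ p y) k) P :=
    ((isL2_proc _).memLp k).integrable one_le_two
  refine ae_eq_condExp_of_forall_setIntegral_eq (past_le ℱ k) hy
    (fun s _ _ => hD.integrableOn) (fun s hs _ => ?_)
    (isPast_proc _ k).aestronglyMeasurable
  refine ext_inner_left ℝ fun c => ?_
  have hs' := past_le ℱ k s hs
  rw [← integral_inner hD.integrableOn, ← integral_inner hy.integrableOn,
    ← integral_indicator hs', ← integral_indicator hs']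
  set g := (isL2_single (P := P) (ℱ := ℱ) (ρ := ρ) k hs c).toH with hg
  have hgk : ∀ᵐ ω ∂P, proc g k ω = s.indicator (fun _ => c) ω := by
    filter_upwards [same_proc_toH (isL2_single (P := P) (ℱ := ℱ) (ρ := ρ) k hs c) k] with ω hω
    rw [hω, Pi.single_eq_same]
  have hgj : ∀ j, j ≠ k → ∀ᵐ ω ∂P, proc g j ω = 0 := by
    intro j hj
    filter_upwards [same_proc_toH (isL2_single (P := P) (ℱ := ℱ) (ρ := ρ) k hs c) j] with ω hω
    rw [hω, Pi.single_eq_of_ne hj]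
    rfl
  have h1 : (inner ℝ g (hφ.nextOp ρ p y) : ℝ) = Real.exp (-ρ * k) *
      ∫ ω, s.indicator (fun ω => inner ℝ c (proc (hφ.nextOp ρ p y) k ω)) ω ∂P := by
    refine (hasSum_inner g (hφ.nextOp ρ p y)).unique ?_
    convert hasSum_single k fun j hj => ?_ using 2
    · refine integral_congr_ae ?_
      filter_upwards [hgk] with ω hω
      rw [hω]
      by_cases hω' : ω ∈ s <;> simp [hω']
    · rw [integral_eq_zero_of_ae, mul_zero]
      filter_upwards [hgj j hj] with ω hω
      rw [hω, inner_zero_left]; rfl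
  -- The delayed test process lives at time `k + 1` only, hence the discount `exp(-ρ (k + 1))`.
  have h2 : (inner ℝ (hφ.shiftOp ρ p g) y : ℝ) = Real.exp (-ρ * (k + 1 : ℕ)) *
      ∫ ω, s.indicator (fun ω => inner ℝ c (φ k ω • proc y (k + 1) ω)) ω ∂P := by
    refine (hasSum_inner (hφ.shiftOp ρ p g) y).unique ?_
    convert hasSum_single (k + 1) fun j hj => ?_ using 2
    · refine integral_congr_ae ?_
      filter_upwards [hgk, hφ.proc_shiftOp_succ g k] with ω hω h
      rw [h, hω]
      by_cases hω' : ω ∈ s <;> simp [hω', inner_smul_left, inner_smul_right]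
    · rw [integral_eq_zero_of_ae, mul_zero]
      cases j with
      | zero =>
        filter_upwards [hφ.proc_shiftOp_zero g] with ω hω
        rw [hω, inner_zero_left]; rfl
      | succ j =>
        filter_upwards [hgj j (by omega), hφ.proc_shiftOp_succ g j] with ω hω h
        rw [h, hω, smul_zero, inner_zero_left]; rfl
  have h3 : (inner ℝ g (hφ.nextOp ρ p y) : ℝ)
      = Real.exp ρ * inner ℝ (hφ.shiftOp ρ p g) y := by
    rw [nextOp, _root_.smul_apply, real_inner_smul_right,
      ContinuousLinearMap.adjoint_inner_right]
  rw [h1, h2, ← mul_assoc, ← Real.exp_add] at h3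
  -- The factor `exp ρ` in `nextOp` is there to absorb this extra discount.
  have e : ρ + -ρ * (k + 1 : ℕ) = -ρ * k := by push_cast; ring
  rw [e] at h3
  exact mul_left_cancel₀ (Real.exp_pos _).ne' h3

end Shift

/-! ### The control problem as an abstract linear-quadratic problem -/

section Problem

variable {Ω : Type*} {m0 : MeasurableSpace Ω} {P : Measure Ω} {ℱ : Filtration ℕ m0} {ρ : ℝ}
  {p : ℕ}

/-- The discounted series of the pointwise inner products converges almost surely, and its sum has
the inner product of `L^{2,ρ}` as expectation. -/
theorem tsum_inner_proc (f g : H P ℱ ρ p) :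
    (∀ᵐ ω ∂P, Summable fun k : ℕ => Real.exp (-ρ * k) * inner ℝ (proc f k ω) (proc g k ω)) ∧
    Integrable (fun ω => ∑' k : ℕ, Real.exp (-ρ * k) * inner ℝ (proc f k ω) (proc g k ω)) P ∧
    ∫ ω, ∑' k : ℕ, Real.exp (-ρ * k) * inner ℝ (proc f k ω) (proc g k ω) ∂P = inner ℝ f g := by
  set u : ℕ → Ω → ℝ := fun k ω => Real.exp (-ρ * k) * inner ℝ (proc f k ω) (proc g k ω) with hu
  have hui : ∀ k, Integrable (u k) P := fun k => by
    have hf := (isL2_proc f).memLp k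
    have hg := (isL2_proc g).memLp k
    refine Integrable.const_mul ((hf.norm.integrable_mul hg.norm).mono' (hf.1.inner hg.1)
      (ae_of_all _ fun ω => norm_inner_le_norm _ _)) _
  have hfin : Integrable (fun z => (inner ℝ (f z) (g z) : ℝ)) (predMeasure P ℱ ρ) :=
    L2.integrable_inner f g
  -- Integrability of the inner product on the predictable space is summability of the `L¹` norms,
  -- which justifies exchanging sum and expectation.
  have hsum : Summable fun k => ∫ ω, ‖u k ω‖ ∂P := by
    convert (hasSum_integral_predMeasure hfin.norm).summable using 2 with k
    rw [← integral_const_mul]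
    congr 1; ext ω
    rw [hu, norm_mul, Real.norm_of_nonneg (Real.exp_pos _).le]
    rfl
  have hlt : ∫⁻ ω, ∑' k, ‖u k ω‖ₑ ∂P ≠ ∞ := by
    rw [lintegral_tsum fun k => (hui k).1.enorm]
    simp_rw [fun k => (ofReal_integral_norm_eq_lintegral_enorm (hui k)).symm]
    exact hsum.tsum_ofReal_ne_top
  have hae : ∀ᵐ ω ∂P, Summable fun k => u k ω := by
    filter_upwards [ae_lt_top' (AEMeasurable.tsum fun k => (hui k).1.enorm) hlt] with ω hω
    exact Summable.of_enorm hω.ne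
  refine ⟨hae, ⟨?_, ?_⟩, ?_⟩
  · refine aestronglyMeasurable_of_tendsto_ae Filter.atTop
      (f := fun N ω => ∑ k ∈ Finset.range N, u k ω) (fun N => ?_) ?_
    · exact Finset.aestronglyMeasurable_fun_sum _ fun k _ => (hui k).1
    · filter_upwards [hae] with ω hω
      exact hω.hasSum.tendsto_sum_nat
  · exact (lintegral_mono fun ω => enorm_tsum_le_tsum_enorm).trans_lt hlt.lt_top
  · refine (hasSum_integral_of_summable_integral_norm hui hsum).unique ?_
    simp only [hu, integral_const_mul]
    exact hasSum_inner f g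

variable {w : ℕ → Ω → ℝ} {n m : ℕ} {c : Coeffs Ω n m} {δ : ℝ}

/-- The standing assumptions of the linear-quadratic problem. -/
structure IsProblem (P : Measure Ω) (ℱ : Filtration ℕ m0) (w : ℕ → Ω → ℝ) (ρ : ℝ)
    (c : Coeffs Ω n m) (δ : ℝ) : Prop where
  prob : IsProbabilityMeasure P
  noise : IsNoise P ℱ w
  A : IsLinf P ℱ c.A
  B : IsLinf P ℱ c.B
  C : IsLinf P ℱ c.C
  α : IsL2 P ℱ ρ c.α
  Q : IsLinf P ℱ c.Q
  L : IsLinf P ℱ c.L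
  R : IsLinf P ℱ c.R
  M_pos : c.M.PosSemidef
  Q_pos : ∀ k, ∀ᵐ ω ∂P, (c.Q k ω).PosSemidef
  L_pos : ∀ k, ∀ᵐ ω ∂P, (c.L k ω).PosSemidef
  δ_pos : 0 < δ
  R_pos : ∀ k, ∀ᵐ ω ∂P, (c.R k ω - δ • (1 : Matrix (Fin m) (Fin m) ℝ)).PosSemidef
  small : ((linfNorm P c.A).toReal + (linfNorm P c.B).toReal) * Real.exp (ρ / 2) < 1

/-- The matrix-valued process that is `M` at time zero and vanishes afterwards. -/
def initialWeight (Ω : Type*) (M : Matrix (Fin p) (Fin p) ℝ) :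
    ℕ → Ω → Matrix (Fin p) (Fin p) ℝ := fun k _ => if k = 0 then M else 0

theorem isLinf_initialWeight (M : Matrix (Fin p) (Fin p) ℝ) :
    IsLinf P ℱ (initialWeight Ω M) := by
  refine isLinf_of_ae_matNorm_le (fun k => stronglyMeasurable_const) (matNorm M) fun k =>
    ae_of_all _ fun ω => ?_
  by_cases hk : k = 0
  · simp [initialWeight, hk]
  · simp [initialWeight, hk, matNorm]

theorem transpose_eq_of_posSemidef {A : Matrix (Fin p) (Fin p) ℝ} (hA : A.PosSemidef) : Aᵀ = A := by
  rw [← conjTranspose_eq_transpose_of_trivial]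
  exact hA.isHermitian

theorem posDef_of_sub_smul_one {A : Matrix (Fin p) (Fin p) ℝ} (hδ : 0 < δ)
    (hA : (A - δ • (1 : Matrix (Fin p) (Fin p) ℝ)).PosSemidef) : A.PosDef := by
  have := PosDef.posSemidef_add hA (PosDef.one.smul hδ)
  rwa [sub_add_cancel] at this

namespace IsProblem

/-- The operator `y ↦ y'`. -/
def meanOp (h : IsProblem P ℱ w ρ c δ) : H P ℱ ρ n →L[ℝ] H P ℱ ρ n :=
  haveI := h.prob
  (isUnitWeight_one : IsUnitWeight P ℱ _).nextOp ρ n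

/-- The operator `y ↦ z'`. -/
def covOp (h : IsProblem P ℱ w ρ c δ) : H P ℱ ρ n →L[ℝ] H P ℱ ρ n :=
  haveI := h.prob
  h.noise.isUnitWeight.nextOp ρ n

/-- The operator `y ↦ A y' + B z'`. -/
def stateOp (h : IsProblem P ℱ w ρ c δ) : H P ℱ ρ n →L[ℝ] H P ℱ ρ n :=
  h.A.mulOp ρ ∘L h.meanOp + h.B.mulOp ρ ∘L h.covOp

/-- The operator of the quadratic form `⟨M y₀, y₀⟩ + ⟨Q y', y'⟩ + ⟨L z', z'⟩`. -/
def weightOp (h : IsProblem P ℱ w ρ c δ) : H P ℱ ρ n →L[ℝ] H P ℱ ρ n :=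
  (isLinf_initialWeight c.M).mulOp ρ + h.meanOp.adjoint ∘L h.Q.mulOp ρ ∘L h.meanOp
    + h.covOp.adjoint ∘L h.L.mulOp ρ ∘L h.covOp

/-- The only place where the size of `ρ` enters: `y ↦ y'` and `y ↦ z'` both have norm at most
`exp(ρ/2)`. -/
theorem norm_stateOp_lt (h : IsProblem P ℱ w ρ c δ) : ‖h.stateOp‖ < 1 := by
  have := h.prob
  refine lt_of_le_of_lt ?_ h.small
  rw [add_mul]
  refine (norm_add_le _ _).trans (add_le_add ?_ ?_)
  · exact (ContinuousLinearMap.opNorm_comp_le _ _).trans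
      (mul_le_mul h.A.norm_mulOp_le isUnitWeight_one.norm_nextOp_le (norm_nonneg _)
        ENNReal.toReal_nonneg)
  · exact (ContinuousLinearMap.opNorm_comp_le _ _).trans
      (mul_le_mul h.B.norm_mulOp_le h.noise.isUnitWeight.norm_nextOp_le (norm_nonneg _)
        ENNReal.toReal_nonneg)

theorem inner_weightOp (h : IsProblem P ℱ w ρ c δ) (y z : H P ℱ ρ n) :
    (inner ℝ (h.weightOp y) z : ℝ) = inner ℝ ((isLinf_initialWeight c.M).mulOp ρ y) z
      + inner ℝ (h.Q.mulOp ρ (h.meanOp y)) (h.meanOp z)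
      + inner ℝ (h.L.mulOp ρ (h.covOp y)) (h.covOp z) := by
  simp [weightOp, inner_add_left, ContinuousLinearMap.adjoint_inner_left]

theorem initialWeight_pos (h : IsProblem P ℱ w ρ c δ) (k : ℕ) :
    ∀ᵐ ω ∂P, (initialWeight Ω c.M k ω).PosSemidef := by
  refine ae_of_all _ fun ω => ?_
  by_cases hk : k = 0
  · simpa [initialWeight, hk] using h.M_pos
  · simpa [initialWeight, hk] using PosSemidef.zero

theorem weightOp_nonneg (h : IsProblem P ℱ w ρ c δ) (y : H P ℱ ρ n) :
    0 ≤ inner ℝ (h.weightOp y) y := by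
  rw [h.inner_weightOp]
  exact add_nonneg (add_nonneg ((isLinf_initialWeight c.M).inner_mulOp_nonneg
    h.initialWeight_pos _) (h.Q.inner_mulOp_nonneg h.Q_pos _)) (h.L.inner_mulOp_nonneg h.L_pos _)

theorem weightOp_symmetric (h : IsProblem P ℱ w ρ c δ) (y z : H P ℱ ρ n) :
    (inner ℝ (h.weightOp y) z : ℝ) = inner ℝ y (h.weightOp z) := by
  rw [real_inner_comm (h.weightOp z) y, h.inner_weightOp, h.inner_weightOp,
    (isLinf_initialWeight c.M).mulOp_symmetric
      fun k => (h.initialWeight_pos k).mono fun _ => transpose_eq_of_posSemidef,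
    h.Q.mulOp_symmetric fun k => (h.Q_pos k).mono fun _ => transpose_eq_of_posSemidef,
    h.L.mulOp_symmetric fun k => (h.L_pos k).mono fun _ => transpose_eq_of_posSemidef]
  simp only [real_inner_comm]

theorem R_posDef (h : IsProblem P ℱ w ρ c δ) (k : ℕ) : ∀ᵐ ω ∂P, (c.R k ω).PosDef :=
  (h.R_pos k).mono fun _ => posDef_of_sub_smul_one h.δ_pos

theorem R_coercive (h : IsProblem P ℱ w ρ c δ) (v : H P ℱ ρ m) :
    δ * ‖v‖ ^ 2 ≤ inner ℝ (h.R.mulOp ρ v) v := h.R.mul_sq_norm_le_inner_mulOp h.R_pos v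

theorem R_symmetric (h : IsProblem P ℱ w ρ c δ) (u v : H P ℱ ρ m) :
    (inner ℝ (h.R.mulOp ρ u) v : ℝ) = inner ℝ u (h.R.mulOp ρ v) :=
  h.R.mulOp_symmetric
    (fun k => (h.R_posDef k).mono fun _ e => transpose_eq_of_posSemidef e.posSemidef) u v

theorem nextMean_eq (h : IsProblem P ℱ w ρ c δ) {y : ℕ → Ω → EuclideanSpace ℝ (Fin n)}
    {Y : H P ℱ ρ n} (e : Same P (proc Y) y) (k : ℕ) :
    nextMean P ℱ y k =ᵐ[P] proc (h.meanOp Y) k := by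
  have := h.prob
  refine Filter.EventuallyEq.symm
    (((isUnitWeight_one (P := P) (ℱ := ℱ)).proc_nextOp Y k).trans ?_)
  refine condExp_congr_ae ?_
  filter_upwards [e (k + 1)] with ω hω
  rw [one_smul, hω]

theorem nextCov_eq (h : IsProblem P ℱ w ρ c δ) {y : ℕ → Ω → EuclideanSpace ℝ (Fin n)}
    {Y : H P ℱ ρ n} (e : Same P (proc Y) y) (k : ℕ) :
    nextCov P ℱ w y k =ᵐ[P] proc (h.covOp Y) k := by
  have := h.prob
  refine Filter.EventuallyEq.symm ((h.noise.isUnitWeight.proc_nextOp Y k).trans ?_)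
  refine condExp_congr_ae ?_
  filter_upwards [e (k + 1)] with ω hω
  rw [hω]

/-- A class and a process representing it are kept separate, so that this applies both to given
processes and to the canonical representatives `proc Y`. -/
theorem backwardEq_iff (h : IsProblem P ℱ w ρ c δ) {y : ℕ → Ω → EuclideanSpace ℝ (Fin n)}
    {v : ℕ → Ω → EuclideanSpace ℝ (Fin m)} {Y : H P ℱ ρ n} {V : H P ℱ ρ m}
    (ey : Same P (proc Y) y) (ev : Same P (proc V) v) :
    BackwardEq P ℱ w c v y ↔ Y = h.stateOp Y + h.C.mulOp ρ V + h.α.toH := by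
  rw [← same_proc_iff]
  refine forall_congr' fun k => Filter.eventually_congr ?_
  filter_upwards [ey k, ev k, h.nextMean_eq ey k, h.nextCov_eq ey k,
    same_proc_add (h.stateOp Y + h.C.mulOp ρ V) h.α.toH k,
    same_proc_add (h.stateOp Y) (h.C.mulOp ρ V) k,
    same_proc_add (h.A.mulOp ρ (h.meanOp Y)) (h.B.mulOp ρ (h.covOp Y)) k,
    h.A.proc_mulOp (h.meanOp Y) k, h.B.proc_mulOp (h.covOp Y) k, h.C.proc_mulOp V k,
    same_proc_toH h.α k] with ω e1 e2 e3 e4 e5 e6 e7 e8 e9 e10 e11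
  have e7' : proc (h.stateOp Y) k ω = _ := e7
  simp only [Pi.add_apply] at e5 e6 e7'
  rw [e5, e6, e7', e8, e9, e10, e11, e1, e2, e3, e4]

theorem isState_iff (h : IsProblem P ℱ w ρ c δ) {y : ℕ → Ω → EuclideanSpace ℝ (Fin n)}
    {v : ℕ → Ω → EuclideanSpace ℝ (Fin m)} (hy : IsL2 P ℱ ρ y) (hv : IsL2 P ℱ ρ v) :
    IsState P ℱ w ρ c v y ↔ hy.toH = h.stateOp hy.toH + h.C.mulOp ρ hv.toH + h.α.toH := by
  rw [← h.backwardEq_iff (same_proc_toH hy) (same_proc_toH hv)]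
  exact ⟨And.right, fun e => ⟨hy, e⟩⟩

theorem exists_isState (h : IsProblem P ℱ w ρ c δ) {v : ℕ → Ω → EuclideanSpace ℝ (Fin m)}
    (hv : IsL2 P ℱ ρ v) : ∃ y, IsState P ℱ w ρ c v y := by
  obtain ⟨Y, hY, -⟩ := existsUnique_eq_add_of_norm_lt_one h.stateOp h.norm_stateOp_lt
    (h.C.mulOp ρ hv.toH + h.α.toH)
  refine ⟨proc Y, isL2_proc Y, (h.backwardEq_iff (fun _ => Filter.EventuallyEq.rfl)
    (same_proc_toH hv)).2 ?_⟩
  rw [add_assoc]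
  exact hY

theorem isState_unique (h : IsProblem P ℱ w ρ c δ) {v : ℕ → Ω → EuclideanSpace ℝ (Fin m)}
    (hv : IsL2 P ℱ ρ v) {y y' : ℕ → Ω → EuclideanSpace ℝ (Fin n)}
    (hy : IsState P ℱ w ρ c v y) (hy' : IsState P ℱ w ρ c v y') : Same P y' y := by
  have e := (h.isState_iff hy.1 hv).1 hy
  have e' := (h.isState_iff hy'.1 hv).1 hy'
  rw [add_assoc] at e e'
  exact toH_eq_iff.1 ((existsUnique_eq_add_of_norm_lt_one h.stateOp h.norm_stateOp_lt
    (h.C.mulOp ρ hv.toH + h.α.toH)).unique e' e)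

/-- The series in the cost converges, and its expectation is the quadratic form of the state and
the control. -/
theorem pathCost_spec (h : IsProblem P ℱ w ρ c δ) {y : ℕ → Ω → EuclideanSpace ℝ (Fin n)}
    {v : ℕ → Ω → EuclideanSpace ℝ (Fin m)} {Y : H P ℱ ρ n} {V : H P ℱ ρ m}
    (ey : Same P (proc Y) y) (ev : Same P (proc V) v) :
    (∀ᵐ ω ∂P, Summable fun k => runningCost P ℱ w ρ c v y k ω) ∧
    Integrable (pathCost P ℱ w ρ c v y) P ∧
    ∫ ω, pathCost P ℱ w ρ c v y ω ∂P
      = inner ℝ (h.weightOp Y) Y + inner ℝ (h.R.mulOp ρ V) V := by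
  obtain ⟨s0, i0, e0⟩ := tsum_inner_proc ((isLinf_initialWeight c.M).mulOp ρ Y) Y
  obtain ⟨s1, i1, e1⟩ := tsum_inner_proc (h.Q.mulOp ρ (h.meanOp Y)) (h.meanOp Y)
  obtain ⟨s2, i2, e2⟩ := tsum_inner_proc (h.L.mulOp ρ (h.covOp Y)) (h.covOp Y)
  obtain ⟨s3, i3, e3⟩ := tsum_inner_proc (h.R.mulOp ρ V) V
  have hrun : ∀ᵐ ω ∂P, ∀ k, runningCost P ℱ w ρ c v y k ω =
      Real.exp (-ρ * k) * inner ℝ (proc (h.Q.mulOp ρ (h.meanOp Y)) k ω) (proc (h.meanOp Y) k ω)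
      + Real.exp (-ρ * k) * inner ℝ (proc (h.L.mulOp ρ (h.covOp Y)) k ω) (proc (h.covOp Y) k ω)
      + Real.exp (-ρ * k) * inner ℝ (proc (h.R.mulOp ρ V) k ω) (proc V k ω) := by
    refine ae_all_iff.2 fun k => ?_
    filter_upwards [ev k, h.nextMean_eq ey k, h.nextCov_eq ey k, h.Q.proc_mulOp (h.meanOp Y) k,
      h.L.proc_mulOp (h.covOp Y) k, h.R.proc_mulOp V k] with ω d1 d2 d3 d4 d5 d6
    rw [runningCost, d2, d3, ← d1, d4, d5, d6, mul_add, mul_add]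
  -- Only `k = 0` contributes, with discount `exp 0 = 1`; this puts the initial cost on the same
  -- footing as the running costs.
  have hinit : ∀ᵐ ω ∂P, inner ℝ (toEuclideanLin c.M (y 0 ω)) (y 0 ω) = ∑' k : ℕ,
      Real.exp (-ρ * k) *
        inner ℝ (proc ((isLinf_initialWeight c.M).mulOp ρ Y) k ω) (proc Y k ω) := by
    filter_upwards [ey 0, ae_all_iff.2 fun k => (isLinf_initialWeight c.M).proc_mulOp Y k]
      with ω d1 d2
    rw [tsum_eq_single 0]
    · rw [d2, d1]; simp [initialWeight]
    · intro k hk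
      rw [d2]; simp [initialWeight, hk]
  have hpath : pathCost P ℱ w ρ c v y =ᵐ[P] fun ω =>
      (∑' k : ℕ, Real.exp (-ρ * k) *
        inner ℝ (proc ((isLinf_initialWeight c.M).mulOp ρ Y) k ω) (proc Y k ω))
      + ((∑' k : ℕ, Real.exp (-ρ * k) *
          inner ℝ (proc (h.Q.mulOp ρ (h.meanOp Y)) k ω) (proc (h.meanOp Y) k ω))
        + (∑' k : ℕ, Real.exp (-ρ * k) *
          inner ℝ (proc (h.L.mulOp ρ (h.covOp Y)) k ω) (proc (h.covOp Y) k ω))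
        + ∑' k : ℕ, Real.exp (-ρ * k) *
          inner ℝ (proc (h.R.mulOp ρ V) k ω) (proc V k ω)) := by
    filter_upwards [hrun, hinit, s1, s2, s3] with ω d1 d2 d3 d4 d5
    rw [pathCost, d2, tsum_congr d1, (d3.add d4).tsum_add d5, d3.tsum_add d4]
  refine ⟨?_, (i0.add ((i1.add i2).add i3)).congr hpath.symm, ?_⟩
  · filter_upwards [hrun, s1, s2, s3] with ω d1 d3 d4 d5
    exact (summable_congr d1).2 ((d3.add d4).add d5)
  · have i12 := i1.add i2
    have i123 := i12.add i3
    simp only [Pi.add_def] at i12 i123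
    rw [integral_congr_ae hpath, integral_add i0 i123, integral_add i12 i3, integral_add i1 i2, e0, e1, e2, e3, h.inner_weightOp]
    ring

theorem cost_eq (h : IsProblem P ℱ w ρ c δ) {y : ℕ → Ω → EuclideanSpace ℝ (Fin n)}
    {v : ℕ → Ω → EuclideanSpace ℝ (Fin m)} (hv : IsL2 P ℱ ρ v) (hy : IsState P ℱ w ρ c v y) :
    cost P ℱ w ρ c v = (1 / 2) *
      (inner ℝ (h.weightOp hy.1.toH) hy.1.toH + inner ℝ (h.R.mulOp ρ hv.toH) hv.toH) := by
  have hex : ∃ y, IsState P ℱ w ρ c v y := ⟨y, hy⟩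
  have hs : IsState P ℱ w ρ c v (stateOf P ℱ w ρ c v) := by
    rw [stateOf, dif_pos hex]
    exact hex.choose_spec
  rw [cost, (h.pathCost_spec (same_proc_toH hs.1) (same_proc_toH hv)).2.2,
    toH_eq_iff.2 (h.isState_unique hv hy hs)]

theorem costWellDefined (h : IsProblem P ℱ w ρ c δ) {v : ℕ → Ω → EuclideanSpace ℝ (Fin m)}
    (hv : IsL2 P ℱ ρ v) : CostWellDefined P ℱ w ρ c v := by
  obtain ⟨y, hy⟩ := h.exists_isState hv
  have hc := h.pathCost_spec (same_proc_toH hy.1) (same_proc_toH hv)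
  exact ⟨y, hy, fun y' hy' => h.isState_unique hv hy hy', hc.1, hc.2.1⟩

theorem stationary_iff (h : IsProblem P ℱ w ρ c δ) {x : ℕ → Ω → EuclideanSpace ℝ (Fin n)}
    {v : ℕ → Ω → EuclideanSpace ℝ (Fin m)} :
    (∀ k, ∀ᵐ ω ∂P, 0 = toEuclideanLin (c.C k ω)ᵀ (x k ω) - toEuclideanLin (c.R k ω) (v k ω))
      ↔ Same P v (feedback c x) := by
  refine forall_congr' fun k => Filter.eventually_congr ?_
  filter_upwards [h.R_posDef k] with ω hω
  have hu : IsUnit (c.R k ω).det := (isUnit_iff_isUnit_det _).1 hω.isUnit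
  rw [eq_comm, sub_eq_zero, feedback]
  constructor
  · intro e
    rw [e, ← toEuclideanLin_mul_apply, nonsing_inv_mul _ hu, toEuclideanLin_one_apply]
  · intro e
    rw [e, ← toEuclideanLin_mul_apply, mul_nonsing_inv _ hu, toEuclideanLin_one_apply]

/-- For `u = R⁻¹ Cᵀ x`, the chain `δ |u|² ≤ ⟨R u, u⟩ = ⟨Cᵀ x, u⟩ ≤ ‖C‖ |x| |u|` gives `|u| ≤ δ⁻¹ ‖C‖
|x|`. -/
theorem isL2_feedback (h : IsProblem P ℱ w ρ c δ) {x : ℕ → Ω → EuclideanSpace ℝ (Fin n)}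
    (hx : IsL2 P ℱ ρ x) : IsL2 P ℱ ρ (feedback c x) := by
  have hinv : ∀ k, StronglyMeasurable[past ℱ k] fun ω => (c.R k ω)⁻¹ := by
    intro k
    -- The formula by determinant and adjugate is measurable everywhere, including the null set
    -- where `R_k` may be singular.
    simp only [Matrix.inv_def, Ring.inverse_eq_inv]
    exact ((continuous_id.matrix_det.comp_stronglyMeasurable (h.R.adapted k)).inv₀).smul
      (continuous_id.matrix_adjugate.comp_stronglyMeasurable (h.R.adapted k))
  have hp : IsPast ℱ (feedback c x) :=
    IsPast.mulMap hinv (IsPast.mulMap h.C.transpose.adapted hx.adapted)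
  have hst := h.stationary_iff.2 (fun k => Filter.EventuallyEq.rfl : Same P (feedback c x) _)
  have hδ := h.δ_pos
  refine ⟨hp, (sqNorm_le_of_ae_le (ℱ := ℱ) (c := δ⁻¹ * (linfNorm P c.C).toReal) hx.adapted hp
    (by positivity) fun k => ?_).trans_lt (ENNReal.mul_lt_top ENNReal.ofReal_lt_top hx.finite)⟩
  filter_upwards [hst k, h.R_pos k, h.C.ae_matNorm_le k] with ω e1 e2 e3
  set u := feedback c x k ω
  have e4 := inner_toEuclideanLin_nonneg e2 u
  rw [map_sub, map_smul, LinearMap.sub_apply, LinearMap.smul_apply, toEuclideanLin_one_apply,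
    inner_sub_left, ← sub_eq_zero.1 e1.symm, real_inner_smul_left, real_inner_self_eq_norm_sq] at e4
  have e5 := real_inner_le_norm (toEuclideanLin (c.C k ω)ᵀ (x k ω)) u
  have e6 := norm_toEuclideanLin_le (c.C k ω)ᵀ (x k ω)
  rw [matNorm_transpose] at e6
  have e7 : ‖toEuclideanLin (c.C k ω)ᵀ (x k ω)‖ ≤ (linfNorm P c.C).toReal * ‖x k ω‖ :=
    e6.trans (by gcongr)
  rw [mul_assoc, ← div_eq_inv_mul, le_div_iff₀ hδ]
  rcases (norm_nonneg u).eq_or_lt with h0 | h0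
  · rw [← h0, zero_mul]; positivity
  · refine le_of_mul_le_mul_right ?_ h0
    nlinarith

/-- The adjoints of `y ↦ y'` and `y ↦ z'` are `exp ρ` times the delays, which makes a backward
operator into a forward recursion. At time `0` the delays vanish and only `-M y_0` remains; at time
`k + 1` the initial weight vanishes and the forward equation remains. -/
theorem costate_iff (h : IsProblem P ℱ w ρ c δ) {x y : ℕ → Ω → EuclideanSpace ℝ (Fin n)}
    {X Y : H P ℱ ρ n} (ex : Same P (proc X) x) (ey : Same P (proc Y) y) :
    ((∀ᵐ ω ∂P, x 0 ω = -toEuclideanLin c.M (y 0 ω)) ∧ ∀ k, ∀ᵐ ω ∂P, x (k + 1) ω =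
      Real.exp ρ • toEuclideanLin (c.A k ω)ᵀ (x k ω)
        - Real.exp ρ • toEuclideanLin (c.Q k ω) (nextMean P ℱ y k ω)
        + w k ω • Real.exp ρ • (toEuclideanLin (c.B k ω)ᵀ (x k ω)
            - toEuclideanLin (c.L k ω) (nextCov P ℱ w y k ω)))
      ↔ X = h.stateOp.adjoint X - h.weightOp Y := by
  have := h.prob
  set F := (isUnitWeight_one (P := P) (ℱ := ℱ)).shiftOp ρ n with hF
  set G := h.noise.isUnitWeight.shiftOp ρ n with hG
  set U := h.A.transpose.mulOp ρ X - h.Q.mulOp ρ (h.meanOp Y) with hU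
  set W := h.B.transpose.mulOp ρ X - h.L.mulOp ρ (h.covOp Y) with hW
  set I := (isLinf_initialWeight (P := P) (ℱ := ℱ) c.M).mulOp ρ Y with hI
  have hD : h.meanOp.adjoint = Real.exp ρ • F := isUnitWeight_one.adjoint_nextOp
  have hZ : h.covOp.adjoint = Real.exp ρ • G := h.noise.isUnitWeight.adjoint_nextOp
  have key : h.stateOp.adjoint X - h.weightOp Y = Real.exp ρ • (F U + G W) - I := by
    simp only [stateOp, weightOp, map_add, ContinuousLinearMap.adjoint_comp, hD, hZ,
      IsLinf.adjoint_mulOp, hU, hW, hI, map_sub, _root_.add_apply, ContinuousLinearMap.comp_apply,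
      _root_.smul_apply]
    module
  have hval : ∀ k, ∀ᵐ ω ∂P, proc (Real.exp ρ • (F U + G W) - I) k ω
      = Real.exp ρ • (proc (F U) k ω + proc (G W) k ω)
        - toEuclideanLin (initialWeight Ω c.M k ω) (y k ω) := by
    intro k
    filter_upwards [same_proc_sub (Real.exp ρ • (F U + G W)) I k,
      same_proc_smul (Real.exp ρ) (F U + G W) k, same_proc_add (F U) (G W) k,
      (isLinf_initialWeight c.M).proc_mulOp Y k, ey k] with ω d1 d2 d3 d4 d5
    rw [d1, Pi.sub_apply, Pi.sub_apply, d2, Pi.smul_apply, Pi.smul_apply, d3, Pi.add_apply,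
      Pi.add_apply, d4, d5]
  rw [key, ← same_proc_iff]
  have hzero : (∀ᵐ ω ∂P, x 0 ω = -toEuclideanLin c.M (y 0 ω))
      ↔ proc X 0 =ᵐ[P] proc (Real.exp ρ • (F U + G W) - I) 0 := by
    refine Filter.eventually_congr ?_
    filter_upwards [ex 0, hval 0, isUnitWeight_one.proc_shiftOp_zero U,
      h.noise.isUnitWeight.proc_shiftOp_zero W] with ω d1 d2 d3 d4
    rw [d1, d2, d3, d4]
    simp [initialWeight]
  have hsucc : ∀ k, (∀ᵐ ω ∂P, x (k + 1) ω =
      Real.exp ρ • toEuclideanLin (c.A k ω)ᵀ (x k ω)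
        - Real.exp ρ • toEuclideanLin (c.Q k ω) (nextMean P ℱ y k ω)
        + w k ω • Real.exp ρ • (toEuclideanLin (c.B k ω)ᵀ (x k ω)
            - toEuclideanLin (c.L k ω) (nextCov P ℱ w y k ω)))
      ↔ proc X (k + 1) =ᵐ[P] proc (Real.exp ρ • (F U + G W) - I) (k + 1) := by
    intro k
    refine Filter.eventually_congr ?_
    filter_upwards [ex (k + 1), ex k, hval (k + 1), isUnitWeight_one.proc_shiftOp_succ U k,
      h.noise.isUnitWeight.proc_shiftOp_succ W k,
      same_proc_sub (h.A.transpose.mulOp ρ X) (h.Q.mulOp ρ (h.meanOp Y)) k,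
      same_proc_sub (h.B.transpose.mulOp ρ X) (h.L.mulOp ρ (h.covOp Y)) k,
      h.A.transpose.proc_mulOp X k, h.B.transpose.proc_mulOp X k,
      h.Q.proc_mulOp (h.meanOp Y) k, h.L.proc_mulOp (h.covOp Y) k,
      h.nextMean_eq ey k, h.nextCov_eq ey k]
      with ω d1 d2 d3 d4 d5 d6 d7 d8 d9 d10 d11 d12 d13
    rw [d1, d3, d4, d5, d6, d7]
    simp only [Pi.sub_apply]
    rw [d8, d9, d10, d11, d12, d13, d2]
    have : toEuclideanLin (initialWeight Ω c.M (k + 1) ω) (y (k + 1) ω) = 0 := by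
      simp [initialWeight]
    rw [this]
    refine Eq.congr rfl ?_
    module
  rw [hzero, forall_congr' hsucc]
  constructor
  · rintro ⟨h0, h1⟩ (_ | k)
    exacts [h0, h1 k]
  · exact fun e => ⟨e 0, fun k => e (k + 1)⟩

theorem isHamiltonianSolution_iff (h : IsProblem P ℱ w ρ c δ)
    {x y : ℕ → Ω → EuclideanSpace ℝ (Fin n)} {v : ℕ → Ω → EuclideanSpace ℝ (Fin m)}
    (hx : IsL2 P ℱ ρ x) (hy : IsL2 P ℱ ρ y) (hv : IsL2 P ℱ ρ v) :
    IsHamiltonianSolution P ℱ w ρ c x y v ↔ IsCritical h.stateOp h.weightOp (h.C.mulOp ρ)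
      (h.R.mulOp ρ) h.α.toH hx.toH hy.toH hv.toH := by
  have hs : (∀ k, ∀ᵐ ω ∂P,
      0 = toEuclideanLin (c.C k ω)ᵀ (x k ω) - toEuclideanLin (c.R k ω) (v k ω))
      ↔ (h.C.mulOp ρ).adjoint hx.toH = h.R.mulOp ρ hv.toH := by
    rw [h.C.adjoint_mulOp, ← same_proc_iff]
    refine forall_congr' fun k => Filter.eventually_congr ?_
    filter_upwards [same_proc_toH hx k, same_proc_toH hv k, h.C.transpose.proc_mulOp hx.toH k,
      h.R.proc_mulOp hv.toH k] with ω d1 d2 d3 d4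
    rw [d3, d4, d1, d2, eq_comm, sub_eq_zero]
  have hc := h.costate_iff (same_proc_toH hx) (same_proc_toH hy)
  have hb := h.backwardEq_iff (same_proc_toH hy) (same_proc_toH hv)
  constructor
  · intro e
    exact ⟨hb.1 e.backward, hc.1 ⟨e.initial, e.forward⟩, hs.1 e.stationary⟩
  · intro e
    have e1 := hc.2 e.costate
    exact ⟨hx, hy, e1.2, hb.2 e.state, e1.1, hs.2 e.stationary⟩

/-- The control in a solution of the Hamiltonian system is the feedback, hence admissible. -/
theorem isHamiltonianSolution_feedback (h : IsProblem P ℱ w ρ c δ)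
    {x y : ℕ → Ω → EuclideanSpace ℝ (Fin n)} {v : ℕ → Ω → EuclideanSpace ℝ (Fin m)}
    (hs : IsHamiltonianSolution P ℱ w ρ c x y v) :
    Same P v (feedback c x) ∧ IsHamiltonianSolution P ℱ w ρ c x y (feedback c x) := by
  have hv := h.stationary_iff.1 hs.stationary
  refine ⟨hv, hs.memX, hs.memY, hs.forward, fun k => ?_, hs.initial,
    h.stationary_iff.2 fun k => Filter.EventuallyEq.rfl⟩
  filter_upwards [hs.backward k, hv k] with ω e1 e2
  rw [e1, e2]

theorem exists_isHamiltonianSolution (h : IsProblem P ℱ w ρ c δ) :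
    ∃ x y, IsHamiltonianSolution P ℱ w ρ c x y (feedback c x) := by
  obtain ⟨X, Y, V, hc⟩ := exists_isCritical h.stateOp h.weightOp h.norm_stateOp_lt (h.C.mulOp ρ)
    (h.R.mulOp ρ) h.α.toH h.weightOp_nonneg h.δ_pos h.R_coercive
  have e : ∀ {q : ℕ} (f : H P ℱ ρ q), (isL2_proc f).toH = f := fun f =>
    same_proc_iff.1 (same_proc_toH _)
  refine ⟨proc X, proc Y, (h.isHamiltonianSolution_feedback
    ((h.isHamiltonianSolution_iff (isL2_proc X) (isL2_proc Y) (isL2_proc V)).2 ?_)).2⟩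
  rwa [e, e, e]

/-- The control `v'` is not assumed to lie in `L^{2,ρ}`: stationarity forces it to be the feedback
of `x'`, which does, and then critical points can be compared. -/
theorem isHamiltonianSolution_unique (h : IsProblem P ℱ w ρ c δ)
    {x y x' y' : ℕ → Ω → EuclideanSpace ℝ (Fin n)} {v' : ℕ → Ω → EuclideanSpace ℝ (Fin m)}
    (hs : IsHamiltonianSolution P ℱ w ρ c x y (feedback c x))
    (hs' : IsHamiltonianSolution P ℱ w ρ c x' y' v') :
    Same P x' x ∧ Same P y' y ∧ Same P v' (feedback c x) := by
  obtain ⟨hv', hf'⟩ := h.isHamiltonianSolution_feedback hs'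
  have e := (h.isHamiltonianSolution_iff hs.memX hs.memY (h.isL2_feedback hs.memX)).1 hs
  have e' := (h.isHamiltonianSolution_iff hs'.memX hs'.memY (h.isL2_feedback hs'.memX)).1 hf'
  obtain ⟨e1, e2, e3⟩ := e.unique h.norm_stateOp_lt h.weightOp_nonneg h.weightOp_symmetric h.δ_pos
    h.R_coercive h.R_symmetric e'
  exact ⟨toH_eq_iff.1 e1, toH_eq_iff.1 e2, hv'.trans (toH_eq_iff.1 e3)⟩

/-- Quadratic growth around the critical control yields both its optimality and the uniqueness of
the optimum. -/
theorem cost_ge (h : IsProblem P ℱ w ρ c δ) {x y : ℕ → Ω → EuclideanSpace ℝ (Fin n)}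
    {u v : ℕ → Ω → EuclideanSpace ℝ (Fin m)} (hs : IsHamiltonianSolution P ℱ w ρ c x y v)
    (hv : IsL2 P ℱ ρ v) (hu : IsL2 P ℱ ρ u) :
    cost P ℱ w ρ c v + δ / 2 * ‖hu.toH - hv.toH‖ ^ 2 ≤ cost P ℱ w ρ c u := by
  obtain ⟨z, hz⟩ := h.exists_isState hu
  have hy : IsState P ℱ w ρ c v y := ⟨hs.memY, hs.backward⟩
  have e := ((h.isHamiltonianSolution_iff hs.memX hs.memY hv).1 hs).cost_ge h.weightOp_nonneg
    h.weightOp_symmetric h.R_coercive h.R_symmetric ((h.isState_iff hz.1 hu).1 hz)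
  rw [h.cost_eq hv hy, h.cost_eq hu hz]
  linarith

theorem isOptimal (h : IsProblem P ℱ w ρ c δ) {x y : ℕ → Ω → EuclideanSpace ℝ (Fin n)}
    {v : ℕ → Ω → EuclideanSpace ℝ (Fin m)} (hs : IsHamiltonianSolution P ℱ w ρ c x y v)
    (hv : IsL2 P ℱ ρ v) : IsOptimal P ℱ w ρ c v := by
  refine ⟨hv, ⟨v, hv, rfl⟩, ?_⟩
  rintro _ ⟨u, hu, rfl⟩
  have := h.cost_ge hs hv hu
  have : 0 ≤ δ / 2 * ‖IsL2.toH hu - hv.toH‖ ^ 2 :=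
    mul_nonneg (half_pos h.δ_pos).le (sq_nonneg _)
  linarith

theorem isOptimal_unique (h : IsProblem P ℱ w ρ c δ) {x y : ℕ → Ω → EuclideanSpace ℝ (Fin n)}
    {u v : ℕ → Ω → EuclideanSpace ℝ (Fin m)} (hs : IsHamiltonianSolution P ℱ w ρ c x y v)
    (hv : IsL2 P ℱ ρ v) (hu : IsOptimal P ℱ w ρ c u) : Same P u v := by
  have h1 := h.cost_ge hs hv hu.1
  have h2 : cost P ℱ w ρ c u ≤ cost P ℱ w ρ c v := hu.2.2 ⟨v, hv, rfl⟩
  have h3 : ‖hu.1.toH - hv.toH‖ ^ 2 ≤ 0 := by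
    have := half_pos h.δ_pos
    by_contra! hlt
    have := mul_pos this hlt
    linarith
  have h4 : hu.1.toH - hv.toH = 0 :=
    norm_eq_zero.1 ((pow_eq_zero_iff two_ne_zero).1 (le_antisymm h3 (sq_nonneg _)))
  exact toH_eq_iff.1 (sub_eq_zero.1 h4)

end IsProblem

theorem mul_exp_half_lt_one_of_lt_neg_log {a b : ℝ≥0∞} (ha : a < ∞) (hb : b < ∞)
    (h : (ρ : EReal) < -ENNReal.log (6 * (a + b) ^ 2)) :
    (a.toReal + b.toReal) * Real.exp (ρ / 2) < 1 := by
  have h1 : ENNReal.log (6 * (a + b) ^ 2) < ((-ρ : ℝ) : EReal) := by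
    rw [EReal.coe_neg]
    exact EReal.lt_neg_of_lt_neg h
  -- Exponentiating in the extended reals also covers `a + b = 0`, where the logarithm is `-∞`; what
  -- results is `6 r² < exp(-ρ)` with `r` the sum of the two norms.
  rw [← EReal.log_exp ((-ρ : ℝ) : EReal), ENNReal.log_lt_log_iff, EReal.exp_coe,
    ENNReal.lt_ofReal_iff_toReal_lt (by finiteness), ENNReal.toReal_mul, ENNReal.toReal_pow,
    ENNReal.toReal_add ha.ne hb.ne] at h1
  have h0 : 0 ≤ a.toReal + b.toReal := by positivity
  set r := a.toReal + b.toReal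
  have h2 : 6 * r ^ 2 < Real.exp (-ρ) := by simpa using h1
  have h3 : Real.exp (-ρ) * (Real.exp (ρ / 2)) ^ 2 = 1 := by
    rw [← Real.exp_nat_mul, ← Real.exp_add]
    simp; ring
  have h4 : 0 < Real.exp (ρ / 2) ^ 2 := by positivity
  -- Since `r² ≤ 6 r² < exp(-ρ)`, multiplying by `exp(ρ/2)² = exp ρ` gives the bound.
  have h5 : (r * Real.exp (ρ / 2)) ^ 2 < 1 := by
    rw [mul_pow, ← h3]
    refine mul_lt_mul_of_pos_right (lt_of_le_of_lt ?_ h2) h4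
    nlinarith [sq_nonneg r]
  exact (sq_lt_one_iff₀ (by positivity)).1 h5

end Problem

end BLQ

end

theorem mainTheorem7 {Ω : Type*} {m0 : MeasurableSpace Ω} (P : Measure Ω) [IsProbabilityMeasure P]
    (ℱ : Filtration ℕ m0) (w : ℕ → Ω → ℝ) (hw : BLQ.IsNoise P ℱ w)
    {n m : ℕ} (ρ : ℝ) (c : BLQ.Coeffs Ω n m)
    (hA : BLQ.IsLinf P ℱ c.A) (hB : BLQ.IsLinf P ℱ c.B) (hC : BLQ.IsLinf P ℱ c.C)
    (hα : BLQ.IsL2 P ℱ ρ c.α)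
    (hQ : BLQ.IsLinf P ℱ c.Q) (hL : BLQ.IsLinf P ℱ c.L) (hR : BLQ.IsLinf P ℱ c.R)
    (hMpos : c.M.PosDef)
    (hQpos : ∀ k, ∀ᵐ ω ∂P, (c.Q k ω).PosSemidef)
    (hLpos : ∀ k, ∀ᵐ ω ∂P, (c.L k ω).PosSemidef)
    (δ : ℝ) (hδ : 0 < δ)
    (hRpos : ∀ k, ∀ᵐ ω ∂P, (c.R k ω - δ • (1 : Matrix (Fin m) (Fin m) ℝ)).PosSemidef)
    (hρ : (ρ : EReal) < -ENNReal.log (6 * (BLQ.linfNorm P c.A + BLQ.linfNorm P c.B) ^ 2)) :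
    (∀ v, BLQ.IsL2 P ℱ ρ v → BLQ.CostWellDefined P ℱ w ρ c v) ∧
    ∃ x y : ℕ → Ω → EuclideanSpace ℝ (Fin n),
      BLQ.IsHamiltonianSolution P ℱ w ρ c x y (BLQ.feedback c x) ∧
      (∀ x' y' v', BLQ.IsHamiltonianSolution P ℱ w ρ c x' y' v' →
        BLQ.Same P x' x ∧ BLQ.Same P y' y ∧ BLQ.Same P v' (BLQ.feedback c x)) ∧
      BLQ.IsOptimal P ℱ w ρ c (BLQ.feedback c x) ∧
      (∀ v', BLQ.IsOptimal P ℱ w ρ c v' → BLQ.Same P v' (BLQ.feedback c x)) := by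
  have h : BLQ.IsProblem P ℱ w ρ c δ := ⟨inferInstance, hw, hA, hB, hC, hα, hQ, hL, hR,
    hMpos.posSemidef, hQpos, hLpos, hδ, hRpos,
    BLQ.mul_exp_half_lt_one_of_lt_neg_log hA.bounded hB.bounded hρ⟩
  obtain ⟨x, y, hs⟩ := h.exists_isHamiltonianSolution
  have hv := h.isL2_feedback hs.memX
  exact ⟨fun v hv => h.costWellDefined hv, x, y, hs,
    fun x' y' v' hs' => h.isHamiltonianSolution_unique hs hs', h.isOptimal hs hv,
    fun v' hv' => h.isOptimal_unique hs hv hv'⟩
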